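/- Let $u,d\in(0,1)$ and put $U=\frac{u}{u+d}$, $D=\frac{d}{u+d}$. Let $\{X_t(x) : t=1,2,\dots,\ x\in\mathbb Z\}$ be $\{0,1\}$-valued random variables such that the processes $(X_t(x))_{t\ge 1}$, $x\in\mathbb Z$, are independent and each of them is a time-homogeneous Markov chain with transition probabilities $P[X_{t+1}(x)=1\mid X_t(x)=0]=u$ and $P[X_{t+1}(x)=0\mid X_t(x)=1]=d$, started from its stationary distribution $P[X_1(x)=1]=U$, $P[X_1(x)=0]=D$. Define the overhead messages by $$M_1(x)=X_1(x),\qquad M_t(x)=X_t(x)\,\bigl[M_{t-1}(x+1)+1\bigr]\quad(t\ge 2),\qquad M_t:=M_t(1),$$ and the vectors $\underline Z_t=(Z_t(1),Z_t(2),\dots)$ by $Z_t(x)=X_{t+1-x}(x)$ for $1\le x\le t$ and $Z_t(x)=0$ for $x>t$. Write $X_t:=X_t(1)$ and $X^{(j)}_t:=X_{jt}$. Let $\mathrm H$ denote the (conditional) Shannon entropy of discrete random variables with the natural logarithm, and let $\mathscr H(Y)=\lim_{t\to\infty}\frac1t\mathrm H(Y_t,\dots,Y_1)$ denote the entropy rate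 of a process $Y$. Then for every integer $j\ge1$ the limits $$\mathscr L_j=\lim_{t\to\infty}\mathrm H(M_t\mid M_{t-1},\dots,M_{t-j+1},\underline Z_{t-j}),\qquad \mathscr U_j=\lim_{t\to\infty}\mathrm H(M_t\mid M_{t-1},\dots,M_{t-j+1}),$$ $$p_j=\lim_{t\to\infty}P\bigl[M_t>\max\{M_{t-1},\dots,M_{t-j}\}\bigr]$$ and the entropy rate $\mathscr H(X^{(j)})$ exist, and for every $j\ge1$ $$\mathscr L_{j+1}=\mathscr L_j+\frac{p_j}{D}\bigl[\mathscr H(X^{(j+1)})-\mathscr H(X^{(j)})\bigr],\qquad \mathscr U_{j+1}=\mathscr L_j+\frac{p_j}{D}\bigl[\mathrm H(X_1)-\mathscr H(X^{(j)})\bigr],$$ with the initial values $$\mathscr L_1=\frac1D\,\mathscr H(X^{(1)}),\qquad \mathscr U_1=\frac1D\,\mathrm H(X_1)=\frac{h(U)}{D},$$ where $h(\lambda)=-\lambda\log\lambda-(1-\lambda)\log(1-\lambda)$ is the binary entropy function. -/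

import Mathlib

open MeasureTheory ProbabilityTheory Filter Topology

noncomputable section

namespace LinkNetwork

/-! ### Entropy of discrete random variables (natural logarithm) -/

section Entropy

variable {Ω α β : Type*} [MeasurableSpace Ω]

/-- Shannon entropy `H(X) = - ∑_a P[X = a] log P[X = a]` of a discrete random variable. -/
def entropy (μ : Measure Ω) (X : Ω → α) : ℝ :=
  ∑' a : α, Real.negMulLog (μ.real {ω | X ω = a})

/-- Conditional Shannon entropy
`H(X | Y) = - ∑_{a,b} P[X = a, Y = b] log P[X = a | Y = b]` of discrete random variables. -/
def condEntropy (μ : Measure Ω) (X : Ω → α) (Y : Ω → β) : ℝ :=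
  ∑' q : α × β, -(μ.real {ω | X ω = q.1 ∧ Y ω = q.2} *
    Real.log (μ.real {ω | X ω = q.1 ∧ Y ω = q.2} / μ.real {ω | Y ω = q.2}))

/-- `h` is the entropy rate `lim_{t → ∞} (1/t) H(Y_t, …, Y_1)` of the process `Y_1, Y_2, …`. -/
def HasEntropyRate (μ : Measure Ω) (Y : ℕ → Ω → α) (h : ℝ) : Prop :=
  Tendsto (fun t : ℕ => (1 / (t : ℝ)) * entropy μ (fun ω (i : Fin t) => Y (i + 1) ω))
    atTop (𝓝 h)

end Entropy

/-! ### The law of the links -/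

/-- Stationary probability of a link being up. -/
def upProb (u d : ℝ) : ℝ := u / (u + d)

/-- Stationary probability of a link being down. -/
def downProb (u d : ℝ) : ℝ := d / (u + d)

/-- The stationary distribution of a link (`true` is up, `false` is down). -/
def statProb (u d : ℝ) : Bool → ℝ
  | true => upProb u d
  | false => downProb u d

/-- `transProb u d a b` is the one-step transition probability `p(b | a)`. -/
def transProb (u d : ℝ) : Bool → Bool → ℝ
  | true, true => 1 - d
  | true, false => d
  | false, true => u
  | false, false => 1 - u

variable {Ω : Type*} [MeasurableSpace Ω]

/-- `X t x` is the state of the link `x ∈ ℤ` at time `t = 1, 2, …` (the index `t = 0` is never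
used). The links are independent, and each link is a stationary time-homogeneous Markov chain
with transition probabilities `transProb u d`. -/
structure IsLinkNetwork (u d : ℝ) (μ : Measure Ω) (X : ℕ → ℤ → Ω → Bool) : Prop where
  measurable : ∀ t : ℕ, 1 ≤ t → ∀ x : ℤ, Measurable (X t x)
  indep : iIndepFun (fun (x : ℤ) (ω : Ω) (t : ℕ) => X (t + 1) x ω) μ
  initial : ∀ (x : ℤ) (b : Bool), μ.real {ω | X 1 x ω = b} = statProb u d b
  markov : ∀ (x : ℤ) (t : ℕ), 1 ≤ t → ∀ a : ℕ → Bool,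
    μ.real {ω | ∀ s ∈ Finset.Icc 1 (t + 1), X s x ω = a s} =
      μ.real {ω | ∀ s ∈ Finset.Icc 1 t, X s x ω = a s} * transProb u d (a t) (a (t + 1))

/-! ### The overhead messages -/

/-- The message `M_t(x)`: `M_1(x) = X_1(x)` and `M_t(x) = X_t(x) (M_{t-1}(x+1) + 1)`.
The value at `t = 0` is a convention that makes the recursion produce `M_1(x) = X_1(x)`. -/
def msgAt (X : ℕ → ℤ → Ω → Bool) : ℕ → ℤ → Ω → ℕ
  | 0, _, _ => 0
  | t + 1, x, ω => (X (t + 1) x ω).toNat * (msgAt X t (x + 1) ω + 1)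

/-- The message process `M_t = M_t(1)`. -/
def msg (X : ℕ → ℤ → Ω → Bool) (t : ℕ) (ω : Ω) : ℕ := msgAt X t 1 ω

/-- `Z_t(x) = X_{t+1-x}(x)` for `1 ≤ x ≤ t`, and `Z_t(x) = 0` for `x > t`. -/
def diagLink (X : ℕ → ℤ → Ω → Bool) (t x : ℕ) (ω : Ω) : Bool :=
  if x ≤ t then X (t + 1 - x) x ω else false

/-- The infinite random vector `Z_t = (Z_t(1), Z_t(2), …)`. -/
def diag (X : ℕ → ℤ → Ω → Bool) (t : ℕ) (ω : Ω) : ℕ → Bool :=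
  fun k => diagLink X t (k + 1) ω

/-- The random vector `(M_{t-1}, …, M_{t-n})` (meaningful for `t > n`). -/
def pastMsgs (X : ℕ → ℤ → Ω → Bool) (t n : ℕ) (ω : Ω) : Fin n → ℕ :=
  fun i => msg X (t - (i + 1)) ω

/-- `H(M_t | M_{t-1}, …, M_{t-j+1})`. -/
def upperEntropy (μ : Measure Ω) (X : ℕ → ℤ → Ω → Bool) (j t : ℕ) : ℝ :=
  condEntropy μ (msg X t) (pastMsgs X t (j - 1))

/-- `H(M_t | M_{t-1}, …, M_{t-j+1}, Z_{t-j})`. -/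
def lowerEntropy (μ : Measure Ω) (X : ℕ → ℤ → Ω → Bool) (j t : ℕ) : ℝ :=
  condEntropy μ (msg X t) (fun ω => (pastMsgs X t (j - 1) ω, diag X (t - j) ω))

/-- `P[M_t > max {M_{t-1}, …, M_{t-j}}]`. -/
def recordProb (μ : Measure Ω) (X : ℕ → ℤ → Ω → Bool) (j t : ℕ) : ℝ :=
  μ.real {ω | ∀ k ∈ Finset.Icc 1 j, msg X (t - k) ω < msg X t ω}

/-- The single-link process observed every `j` steps: `X^{(j)}_t = X_{jt}(1)`. -/
def skipLink (X : ℕ → ℤ → Ω → Bool) (j t : ℕ) (ω : Ω) : Bool := X (j * t) 1 ω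

end LinkNetwork

end

noncomputable section

namespace LinkNetwork

/-! ### Transition probabilities -/

/-! `M_t` is the length of the initial run of up links along the diagonal `X_t(1), X_{t-1}(2), …`,
so observing it is the same as observing the states `X_{t-y}(y+1)` for `y ≤ M_t`, `y < t`: the run
and the down link that ends it, if any. Hence `M_{t-i}` shows the link `y + 1` with lag `i`
(relative to time `t - y`) exactly when `y ≤ M_{t-i}`, while `Z_{t-j}` shows every link that is
still on its diagonal with lag `j`.

Links are independent and Markov, so the conditional probability of `M_t` is a product over `y ≤
M_t`, in which the link `y + 1` is predicted from its smallest observed lag only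
(`measureReal_msg_and`). Taking logarithms, the conditional entropy is the sum over `y` of the
expected log-loss at the link `y + 1`, counted when `y ≤ M_t` (`condEntropy_msg`).

Compare now the observation behind `𝓛_j` with the one behind `𝓛_{j+1}` or `𝓤_{j+1}`. If one of the
last `j` messages reaches the link `y + 1`, all of them have the same smallest lag. Otherwise the
lag is `j` for `𝓛_j`, `j + 1` for `𝓛_{j+1}`, and there is no information for `𝓤_{j+1}`. The event
`M_{t-1}, …, M_{t-j} < y ≤ M_t` involves only the first `y` links, hence is independent of the link
`y + 1`; the change at `y` is its probability times a difference of single-link entropies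
(`meanLoss_sub`).

Summed over `y`, these probabilities tend to `p_j / D`: a record with value `m` is such an event
with `y = m` together with an independent down state of the link `m + 1` (`tendsto_recordProb`). The
tail bound `P[M_t ≥ y] ≤ U^y` gives dominated convergence, and the single-link entropy at lag `j` is
the entropy rate of `X^{(j)}` by the chain rule for a stationary Markov chain. -/

/-- The `(n + 1)`-step transition probabilities of a link. -/
def stepProb (u d : ℝ) : ℕ → Bool → Bool → ℝ
  | 0, a, b => transProb u d a b
  | n + 1, a, b => ∑ c, stepProb u d n a c * transProb u d c b

/-- The law of a link given its state `n ≥ 1` steps ago; for `n = 0` there is no information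
and the law is the stationary one. -/
def lagProb (u d : ℝ) : ℕ → Bool → Bool → ℝ
  | 0, _, b => statProb u d b
  | n + 1, a, b => stepProb u d n a b

section Transition

variable {u d : ℝ}

lemma transProb_pos (hu : u ∈ Set.Ioo (0 : ℝ) 1) (hd : d ∈ Set.Ioo (0 : ℝ) 1) (a b : Bool) :
    0 < transProb u d a b := by
  obtain ⟨hu0, hu1⟩ := hu
  obtain ⟨hd0, hd1⟩ := hd
  cases a <;> cases b <;> simp [transProb] <;> linarith

lemma statProb_pos (hu : u ∈ Set.Ioo (0 : ℝ) 1) (hd : d ∈ Set.Ioo (0 : ℝ) 1) (a : Bool) :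
    0 < statProb u d a := by
  have hu0 := hu.1
  have hd0 := hd.1
  cases a <;> simp only [statProb, upProb, downProb] <;> positivity

lemma upProb_add_downProb (hu : u ∈ Set.Ioo (0 : ℝ) 1) (hd : d ∈ Set.Ioo (0 : ℝ) 1) :
    upProb u d + downProb u d = 1 := by
  have : u + d ≠ 0 := by linarith [hu.1, hd.1]
  simp only [upProb, downProb]
  field_simp

lemma sum_statProb (hu : u ∈ Set.Ioo (0 : ℝ) 1) (hd : d ∈ Set.Ioo (0 : ℝ) 1) :
    ∑ b, statProb u d b = 1 := by
  simpa [statProb] using upProb_add_downProb hu hd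

lemma sum_statProb_mul_transProb (hu : u ∈ Set.Ioo (0 : ℝ) 1) (hd : d ∈ Set.Ioo (0 : ℝ) 1)
    (b : Bool) : ∑ a, statProb u d a * transProb u d a b = statProb u d b := by
  have : u + d ≠ 0 := by linarith [hu.1, hd.1]
  cases b <;> simp [statProb, transProb, upProb, downProb] <;> field_simp <;> ring

lemma stepProb_pos (hu : u ∈ Set.Ioo (0 : ℝ) 1) (hd : d ∈ Set.Ioo (0 : ℝ) 1) (n : ℕ) :
    ∀ a b : Bool, 0 < stepProb u d n a b := by
  induction n with
  | zero => exact transProb_pos hu hd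
  | succ n ih =>
    intro a b
    exact Finset.sum_pos (fun c _ => mul_pos (ih a c) (transProb_pos hu hd c b)) ⟨true, by simp⟩

lemma lagProb_pos (hu : u ∈ Set.Ioo (0 : ℝ) 1) (hd : d ∈ Set.Ioo (0 : ℝ) 1) (n : ℕ)
    (a b : Bool) : 0 < lagProb u d n a b := by
  cases n with
  | zero => exact statProb_pos hu hd b
  | succ n => exact stepProb_pos hu hd n a b

end Transition

/-! ### The Markov property of a single link -/

variable {Ω : Type*}

/-- The event that the link `x` is in the states prescribed by `a` at the times in `T`. -/
def linkEvent (X : ℕ → ℤ → Ω → Bool) (x : ℤ) (T : Finset ℕ) (a : ℕ → Bool) : Set Ω :=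
  {ω | ∀ s ∈ T, X s x ω = a s}

lemma linkEvent_congr (X : ℕ → ℤ → Ω → Bool) (x : ℤ) {T : Finset ℕ} {a b : ℕ → Bool}
    (h : ∀ s ∈ T, a s = b s) : linkEvent X x T a = linkEvent X x T b := by
  ext ω
  exact forall₂_congr fun s hs => by rw [h s hs]

section Link

variable [MeasurableSpace Ω] {μ : Measure Ω} {u d : ℝ} {X : ℕ → ℤ → Ω → Bool}

lemma IsLinkNetwork.measureReal_linkEvent_eq_sum [IsFiniteMeasure μ]
    (hX : IsLinkNetwork u d μ X) (x : ℤ)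
    {T : Finset ℕ} (a : ℕ → Bool) {r : ℕ} (hr : r ∉ T) (hr1 : 1 ≤ r) :
    μ.real (linkEvent X x T a) =
      ∑ c, μ.real (linkEvent X x (insert r T) (Function.update a r c)) := by
  have key : ∀ c, linkEvent X x (insert r T) (Function.update a r c) =
      linkEvent X x T a ∩ X r x ⁻¹' {c} := by
    intro c
    ext ω
    simp only [linkEvent, Set.mem_ofPred_eq, Finset.forall_mem_insert, Function.update_self,
      Set.mem_inter_iff, Set.mem_preimage, Set.mem_singleton_iff]
    rw [and_comm]
    refine and_congr_left fun _ => forall₂_congr fun s hs => ?_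
    rw [Function.update_of_ne (by rintro rfl; exact hr hs)]
  have hcompl : X r x ⁻¹' {false} = (X r x ⁻¹' {true})ᶜ := by
    ext ω; simp
  rw [Fintype.sum_bool, key, key, hcompl, ← Set.sdiff_eq]
  exact (measureReal_inter_add_sdiff (hX.measurable r hr1 x (measurableSet_singleton _))).symm

/-- The Markov hypothesis speaks of complete paths only. Unobserved times before `s` are filled in
one by one, summing over the state there, by induction on their number. -/
lemma IsLinkNetwork.measureReal_linkEvent_insert_succ [IsFiniteMeasure μ]
    (hX : IsLinkNetwork u d μ X) (x : ℤ) {s : ℕ} (hs : 1 ≤ s) (T : Finset ℕ)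
    (hT : T ⊆ Finset.Icc 1 s) (hsT : s ∈ T) (a : ℕ → Bool) :
    μ.real (linkEvent X x (insert (s + 1) T) a) =
      μ.real (linkEvent X x T a) * transProb u d (a s) (a (s + 1)) := by
  induction hn : (Finset.Icc 1 s \ T).card generalizing T a with
  | zero =>
    obtain rfl : T = Finset.Icc 1 s :=
      hT.antisymm (Finset.sdiff_eq_empty_iff_subset.1 (Finset.card_eq_zero.1 hn))
    rw [Finset.insert_Icc_right_eq_Icc_add_one (by omega)]
    exact hX.markov x s hs a
  | succ n ih =>
    obtain ⟨r, hr⟩ : (Finset.Icc 1 s \ T).Nonempty := Finset.card_pos.1 (by omega)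
    have hr' := hr
    rw [Finset.mem_sdiff, Finset.mem_Icc] at hr'
    obtain ⟨⟨hr1, hrs⟩, hrT⟩ := hr'
    have hne : r ≠ s := fun h => hrT (h ▸ hsT)
    rw [hX.measureReal_linkEvent_eq_sum x a hrT hr1,
      hX.measureReal_linkEvent_eq_sum x (T := insert (s + 1) T)
        a (r := r) (by simp [hrT]; omega) hr1, Finset.sum_mul]
    refine Finset.sum_congr rfl fun c _ => ?_
    rw [Finset.insert_comm, ih (insert r T)
      (Finset.insert_subset (Finset.mem_Icc.2 ⟨hr1, hrs⟩) hT) (Finset.mem_insert_of_mem hsT),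
      Function.update_of_ne hne.symm, Function.update_of_ne (by omega)]
    have h1 : Finset.Icc 1 s \ insert r T = (Finset.Icc 1 s \ T).erase r := by
      ext q; simp; tauto
    rw [h1, Finset.card_erase_of_mem hr, hn]
    rfl

/-- Chapman–Kolmogorov: split according to the state one step before the last time. -/
lemma IsLinkNetwork.measureReal_linkEvent_insert_add [IsFiniteMeasure μ]
    (hX : IsLinkNetwork u d μ X) (x : ℤ) {s : ℕ} (hs : 1 ≤ s) {T : Finset ℕ}
    (hT : T ⊆ Finset.Icc 1 s) (hsT : s ∈ T) (i : ℕ) (a : ℕ → Bool) :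
    μ.real (linkEvent X x (insert (s + (i + 1)) T) a) =
      μ.real (linkEvent X x T a) * stepProb u d i (a s) (a (s + (i + 1))) := by
  have hT1 : ∀ q ∈ T, 1 ≤ q ∧ q ≤ s := fun q hq => Finset.mem_Icc.1 (hT hq)
  induction i generalizing a with
  | zero => exact hX.measureReal_linkEvent_insert_succ x hs T hT hsT a
  | succ i ih =>
    have hnot : s + (i + 1) ∉ insert (s + (i + 1 + 1)) T := by
      rw [Finset.mem_insert]
      rintro (h | h)
      · omega
      · have := hT1 _ h; omega
    rw [hX.measureReal_linkEvent_eq_sum x (T := insert (s + (i + 1 + 1)) T) a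
      (r := s + (i + 1)) hnot (by omega), stepProb, Finset.mul_sum]
    refine Finset.sum_congr rfl fun c _ => ?_
    have hsub : insert (s + (i + 1)) T ⊆ Finset.Icc 1 (s + (i + 1)) := by
      intro q hq
      rw [Finset.mem_insert] at hq
      rw [Finset.mem_Icc]
      rcases hq with h | h
      · omega
      · have := hT1 _ h; omega
    rw [Finset.insert_comm, ← add_assoc s (i + 1) 1,
      hX.measureReal_linkEvent_insert_succ x (by omega) _ hsub (Finset.mem_insert_self _ _),
      ih, Function.update_self, Function.update_of_ne (by omega), Function.update_of_ne (by omega),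
      linkEvent_congr X x (b := a)]
    · ring
    · intro q hq
      have := hT1 q hq
      rw [Function.update_of_ne (by omega)]

lemma IsLinkNetwork.measureReal_state [IsFiniteMeasure μ]
    (hX : IsLinkNetwork u d μ X) (hu : u ∈ Set.Ioo (0 : ℝ) 1) (hd : d ∈ Set.Ioo (0 : ℝ) 1)
    (x : ℤ) {s : ℕ} (hs : 1 ≤ s) (a : ℕ → Bool) :
    μ.real (linkEvent X x {s} a) = statProb u d (a s) := by
  induction s, hs using Nat.le_induction generalizing a with
  | base => simpa [linkEvent] using hX.initial x (a 1)
  | succ s hs ih =>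
    rw [hX.measureReal_linkEvent_eq_sum x (T := {s + 1}) a (r := s) (by simp) hs,
      ← sum_statProb_mul_transProb hu hd]
    refine Finset.sum_congr rfl fun c _ => ?_
    rw [Finset.pair_comm, hX.measureReal_linkEvent_insert_succ x hs {s}
      (by simpa using hs) (by simp), ih]
    simp

/-- Prediction of a link from its observed past: only the last observation matters. -/
lemma IsLinkNetwork.measureReal_linkEvent_insert [IsProbabilityMeasure μ]
    (hX : IsLinkNetwork u d μ X) (hu : u ∈ Set.Ioo (0 : ℝ) 1) (hd : d ∈ Set.Ioo (0 : ℝ) 1)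
    (x : ℤ) {n : ℕ} (hn : 1 ≤ n) (S : Finset ℕ) (hS : ∀ i ∈ S, 1 ≤ i ∧ i < n) (a : ℕ → Bool) :
    μ.real (linkEvent X x (insert n (S.image (n - ·))) a) =
      μ.real (linkEvent X x (S.image (n - ·)) a) *
        lagProb u d (sInf (S : Set ℕ)) (a (n - sInf (S : Set ℕ))) (a n) := by
  -- With no observation `sInf ∅ = 0`, and `lagProb` at lag `0` is the stationary law, so the
  -- formula covers this case as well.
  rcases S.eq_empty_or_nonempty with rfl | hne
  · have h1 : linkEvent X x ∅ a = Set.univ := by ext; simp [linkEvent]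
    simp [lagProb, h1, hX.measureReal_state hu hd x hn]
  · have hmem : sInf (S : Set ℕ) ∈ S := by exact_mod_cast Nat.sInf_mem (s := (S : Set ℕ)) hne
    have hle : ∀ i ∈ S, sInf (S : Set ℕ) ≤ i := fun i hi => Nat.sInf_le (by exact_mod_cast hi)
    generalize sInf (S : Set ℕ) = l at hmem hle ⊢
    obtain ⟨hl1, hln⟩ := hS l hmem
    obtain ⟨k, rfl⟩ : ∃ k, l = k + 1 := ⟨l - 1, by omega⟩
    have hsub : S.image (n - ·) ⊆ Finset.Icc 1 (n - (k + 1)) := by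
      intro q hq
      obtain ⟨i, hi, rfl⟩ := Finset.mem_image.1 hq
      have := hS i hi
      have := hle i hi
      rw [Finset.mem_Icc]
      omega
    have := hX.measureReal_linkEvent_insert_add x (s := n - (k + 1)) (by omega) hsub
      (Finset.mem_image_of_mem (n - ·) hmem) k a
    rwa [show n - (k + 1) + (k + 1) = n by omega] at this

/-- The event contains a complete path, whose probability is a product of positive factors. -/
lemma IsLinkNetwork.measureReal_linkEvent_pos [IsFiniteMeasure μ]
    (hX : IsLinkNetwork u d μ X) (hu : u ∈ Set.Ioo (0 : ℝ) 1) (hd : d ∈ Set.Ioo (0 : ℝ) 1)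
    (x : ℤ) {T : Finset ℕ} (hT : ∀ s ∈ T, 1 ≤ s) (a : ℕ → Bool) :
    0 < μ.real (linkEvent X x T a) := by
  have h : ∀ n, 1 ≤ n → 0 < μ.real (linkEvent X x (Finset.Icc 1 n) a) := by
    intro n hn
    induction n, hn using Nat.le_induction with
    | base =>
      rw [Finset.Icc_self, hX.measureReal_state hu hd x le_rfl]
      exact statProb_pos hu hd _
    | succ n hn ih =>
      rw [← Finset.insert_Icc_right_eq_Icc_add_one (by omega),
        hX.measureReal_linkEvent_insert_succ x hn _ subset_rfl (by simpa using hn)]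
      exact mul_pos ih (transProb_pos hu hd _ _)
  refine (h (T.sup id + 1) (by omega)).trans_le (measureReal_mono fun ω hω s hs => hω s ?_)
  have : s ≤ T.sup id := Finset.le_sup (f := id) hs
  exact Finset.mem_Icc.2 ⟨hT s hs, by omega⟩

/-- The law of a link observed at the times `s, s + j, …, s + n j`. -/
lemma IsLinkNetwork.measureReal_path [IsProbabilityMeasure μ]
    (hX : IsLinkNetwork u d μ X) (hu : u ∈ Set.Ioo (0 : ℝ) 1) (hd : d ∈ Set.Ioo (0 : ℝ) 1)
    (x : ℤ) {s j : ℕ} (hs : 1 ≤ s) (hj : 1 ≤ j) (n : ℕ) (a : ℕ → Bool) :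
    μ.real {ω | ∀ i < n + 1, X (s + j * i) x ω = a i} =
      statProb u d (a 0) * ∏ i ∈ Finset.range n, lagProb u d j (a i) (a (i + 1)) := by
  -- `linkEvent` prescribes states by time, so the index along the path is recovered from the time
  -- `q` as `(q - s) / j`.
  have hev : ∀ n, {ω | ∀ i < n + 1, X (s + j * i) x ω = a i} =
      linkEvent X x ((Finset.range (n + 1)).image (s + j * ·)) (fun q => a ((q - s) / j)) := by
    intro n
    ext ω
    simp only [linkEvent, Set.mem_ofPred_eq, Finset.forall_mem_image, Finset.mem_range]
    refine forall₂_congr fun i _ => ?_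
    rw [Nat.add_sub_cancel_left, Nat.mul_div_cancel_left _ (by omega)]
  induction n with
  | zero =>
    rw [hev]
    simpa using hX.measureReal_state hu hd x hs (fun q => a ((q - s) / j))
  | succ n ih =>
    rw [Finset.prod_range_succ, ← mul_assoc, ← ih, hev, hev, Finset.range_add_one (n := n + 1),
      Finset.image_insert]
    obtain ⟨k, rfl⟩ : ∃ k, j = k + 1 := ⟨j - 1, by omega⟩
    have hsub : (Finset.range (n + 1)).image (s + (k + 1) * ·) ⊆
        Finset.Icc 1 (s + (k + 1) * n) := by
      intro q hq
      obtain ⟨i, hi, rfl⟩ := Finset.mem_image.1 hq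
      have := Nat.mul_le_mul_left (k + 1) (Nat.lt_succ_iff.1 (Finset.mem_range.1 hi))
      rw [Finset.mem_Icc]
      omega
    have := hX.measureReal_linkEvent_insert_add x (s := s + (k + 1) * n) (by omega) hsub
      (Finset.mem_image_of_mem (s + (k + 1) * ·) (by simp)) k (fun q => a ((q - s) / (k + 1)))
    rw [show s + (k + 1) * n + (k + 1) = s + (k + 1) * (n + 1) by ring] at this
    simp only [Nat.add_sub_cancel_left, Nat.mul_div_cancel_left _ (Nat.succ_pos k)] at this
    exact this

lemma IsLinkNetwork.measureReal_pair [IsProbabilityMeasure μ]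
    (hX : IsLinkNetwork u d μ X) (hu : u ∈ Set.Ioo (0 : ℝ) 1) (hd : d ∈ Set.Ioo (0 : ℝ) 1)
    (x : ℤ) {s j : ℕ} (hs : 1 ≤ s) (hj : 1 ≤ j) (a b : Bool) :
    μ.real {ω | X s x ω = a ∧ X (s + j) x ω = b} = statProb u d a * lagProb u d j a b := by
  have h := hX.measureReal_path hu hd x hs hj 1 (fun i => if i = 0 then a else b)
  simp only [Finset.range_one, Finset.prod_singleton, if_true, zero_add, one_ne_zero,
    if_false] at h
  rw [← h]
  congr 1
  ext ω
  simp only [Set.mem_ofPred_eq]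
  constructor
  · rintro ⟨h1, h2⟩ i hi
    interval_cases i <;> simp [h1, h2]
  · intro h
    have h0 := h 0 (by omega)
    have h1 := h 1 (by omega)
    simp at h0 h1
    exact ⟨h0, h1⟩

end Link

end LinkNetwork

end

noncomputable section

namespace LinkNetwork

/-! ### Functions of finitely many discrete observations -/

section Finite

variable {Ω ι : Type*} [MeasurableSpace Ω] {μ : Measure Ω} [IsProbabilityMeasure μ]
  [Fintype ι] [MeasurableSpace ι] [MeasurableSingletonClass ι] {V : Ω → ι}

lemma integral_comp_fintype (hV : Measurable V) (φ : ι → ℝ) :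
    ∫ ω, φ (V ω) ∂μ = ∑ v, μ.real {ω | V ω = v} * φ v := by
  have : IsFiniteMeasure (μ.map V) := Measure.isFiniteMeasure_map μ V
  rw [← integral_map (φ := V) (f := φ) hV.aemeasurable
    (Measurable.of_discrete).aestronglyMeasurable, integral_fintype Integrable.of_finite]
  refine Finset.sum_congr rfl fun v _ => ?_
  rw [smul_eq_mul, map_measureReal_apply hV (measurableSet_singleton v)]
  rfl

/-- All quantities at time `t` are functions of the finite-valued `pattern X t`; this lemma and the
next make their measurability and integrability automatic. -/
lemma measurable_of_factorsThrough {γ : Type*} [Nonempty γ] [MeasurableSpace γ] {f : Ω → γ}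
    (hV : Measurable V) (hf : f.FactorsThrough V) : Measurable f := by
  obtain ⟨e, rfl⟩ := (Function.factorsThrough_iff f).1 hf
  exact Measurable.of_discrete.comp hV

lemma integrable_of_factorsThrough {f : Ω → ℝ} (hV : Measurable V) (hf : f.FactorsThrough V) :
    Integrable f μ := by
  obtain ⟨e, rfl⟩ := (Function.factorsThrough_iff f).1 hf
  have : IsFiniteMeasure (μ.map V) := Measure.isFiniteMeasure_map μ V
  exact (Integrable.of_finite (μ := μ.map V)).comp_measurable hV

lemma condEntropy_eq_integral {α β : Type*} {X : Ω → α} {Y : Ω → β} (hV : Measurable V)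
    (hX : X.FactorsThrough V) (hY : Y.FactorsThrough V) :
    condEntropy μ X Y = ∫ ω, -Real.log (μ.real {ω' | X ω' = X ω ∧ Y ω' = Y ω} /
      μ.real {ω' | Y ω' = Y ω}) ∂μ := by
  classical
  have hne : Nonempty Ω := nonempty_of_isProbabilityMeasure μ
  have : Nonempty α := hne.map X
  have : Nonempty β := hne.map Y
  obtain ⟨e, rfl⟩ := (Function.factorsThrough_iff X).1 hX
  obtain ⟨e', rfl⟩ := (Function.factorsThrough_iff Y).1 hY
  set f : α × β → ℝ := fun q =>
    -Real.log (μ.real {ω' | (e ∘ V) ω' = q.1 ∧ (e' ∘ V) ω' = q.2} /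
      μ.real {ω' | (e' ∘ V) ω' = q.2}) with hf
  set R : Finset (α × β) := Finset.univ.image fun v => (e v, e' v) with hR
  have hmeas : ∀ q : α × β, MeasurableSet {ω' | (e ∘ V) ω' = q.1 ∧ (e' ∘ V) ω' = q.2} := by
    intro q
    exact hV (Set.toFinite {v | e v = q.1 ∧ e' v = q.2}).measurableSet
  -- Only finitely many pairs of values occur; the integrand is a finite sum over them, and the
  -- remaining terms of the series vanish.
  have hind : ∀ ω, f (e (V ω), e' (V ω)) =
      ∑ q ∈ R, Set.indicator {ω' | (e ∘ V) ω' = q.1 ∧ (e' ∘ V) ω' = q.2} (fun _ => f q) ω := by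
    intro ω
    rw [Finset.sum_eq_single (e (V ω), e' (V ω))]
    · rw [Set.indicator_of_mem]
      simp
    · intro q _ hq
      refine Set.indicator_of_notMem ?_ _
      rintro ⟨h1, h2⟩
      exact hq (Prod.ext h1.symm h2.symm)
    · intro h
      exact absurd (Finset.mem_image_of_mem _ (Finset.mem_univ _)) h
  change _ = ∫ ω, f (e (V ω), e' (V ω)) ∂μ
  simp_rw [hind]
  rw [integral_finsetSum _ fun q _ => (integrable_const _).indicator (hmeas q), condEntropy,
    tsum_eq_sum (s := R)]
  · refine Finset.sum_congr rfl fun q _ => ?_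
    rw [integral_indicator_const _ (hmeas q), smul_eq_mul, hf, mul_neg]
  · intro q hq
    have : {ω | (e ∘ V) ω = q.1 ∧ (e' ∘ V) ω = q.2} = ∅ := by
      ext ω
      simp only [Set.mem_ofPred_eq, Set.mem_empty_iff_false, iff_false]
      rintro ⟨h1, h2⟩
      exact hq (Finset.mem_image.2 ⟨V ω, Finset.mem_univ _, Prod.ext h1 h2⟩)
    rw [this]
    simp

lemma entropy_eq_integral (hV : Measurable V) :
    entropy μ V = ∫ ω, -Real.log (μ.real {ω' | V ω' = V ω}) ∂μ := by
  rw [integral_comp_fintype hV (fun v => -Real.log (μ.real {ω' | V ω' = v})), entropy,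
    tsum_fintype]
  refine Finset.sum_congr rfl fun v _ => ?_
  rw [Real.negMulLog, neg_mul, mul_neg]

end Finite

/-! ### Messages as functions of the links -/

section Messages

variable {Ω : Type*} {X : ℕ → ℤ → Ω → Bool}

lemma le_msgAt_iff (t : ℕ) (x : ℤ) (m : ℕ) (ω : Ω) :
    m ≤ msgAt X t x ω ↔ m ≤ t ∧ ∀ y < m, X (t - y) (x + y) ω = true := by
  induction t generalizing x m with
  | zero =>
    simp only [msgAt, Nat.le_zero]
    refine ⟨?_, fun h => h.1⟩
    rintro rfl
    simp
  | succ t ih =>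
    rcases m with _ | m
    · simp
    · have h1 : m + 1 ≤ msgAt X (t + 1) x ω ↔ X (t + 1) x ω = true ∧ m ≤ msgAt X t (x + 1) ω := by
        rw [msgAt]
        cases X (t + 1) x ω <;> simp
      rw [h1, ih, Nat.succ_le_succ_iff]
      constructor
      · rintro ⟨h0, hm, h⟩
        refine ⟨hm, fun y hy => ?_⟩
        rcases y with _ | y
        · simpa using h0
        · have := h y (by omega)
          rw [Nat.add_sub_add_right]
          rw [← this]
          push_cast
          ring_nf
      · rintro ⟨hm, h⟩
        refine ⟨by simpa using h 0 (by omega), hm, fun y hy => ?_⟩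
        have := h (y + 1) (by omega)
        rw [Nat.add_sub_add_right] at this
        rw [← this]
        push_cast
        ring_nf

lemma le_msg_iff (t m : ℕ) (ω : Ω) :
    m ≤ msg X t ω ↔ m ≤ t ∧ ∀ y < m, X (t - y) (y + 1) ω = true := by
  rw [msg, le_msgAt_iff]
  simp only [add_comm]

lemma msg_le (t : ℕ) (ω : Ω) : msg X t ω ≤ t := ((le_msg_iff t _ ω).1 le_rfl).1

/-- The bound `y ≤ msg X t ω` is not strict because the down link ending the run is seen too; `y <
t` excludes it when the run fills the whole diagonal. -/
lemma msg_eq_msg_iff (t : ℕ) (ω ω' : Ω) :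
    msg X t ω' = msg X t ω ↔
      ∀ y < t, y ≤ msg X t ω → X (t - y) (y + 1) ω' = X (t - y) (y + 1) ω := by
  have hval : ∀ ω : Ω, ∀ y < t, y ≤ msg X t ω →
      X (t - y) (y + 1) ω = decide (y < msg X t ω) := by
    intro ω y hy hle
    rcases hle.lt_or_eq with h | h
    · simpa [h] using ((le_msg_iff t _ ω).1 le_rfl).2 y h
    · by_contra hne
      have htrue : X (t - y) (y + 1) ω = true := by simpa [h] using hne
      have : y + 1 ≤ msg X t ω := by
        refine (le_msg_iff t _ ω).2 ⟨hy, fun z hz => ?_⟩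
        rcases (Nat.lt_succ_iff.1 hz).lt_or_eq with h' | rfl
        · exact ((le_msg_iff t _ ω).1 hle).2 z h'
        · exact htrue
      omega
  constructor
  · intro h y hy hle
    rw [hval ω y hy hle, hval ω' y hy (h ▸ hle), h]
  · intro h
    have hmt := msg_le (X := X) t ω
    refine le_antisymm ?_ ?_
    · by_contra! hlt
      have h1 := ((le_msg_iff t _ ω').1 (Nat.succ_le_of_lt hlt))
      have h2 := h _ h1.1 le_rfl
      rw [h1.2 _ (Nat.lt_succ_self _), hval ω _ h1.1 le_rfl] at h2
      simp at h2
    · refine (le_msg_iff t _ ω').2 ⟨hmt, fun y hy => ?_⟩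
      rw [h y (by omega) hy.le, hval ω y (by omega) hy.le]
      simpa using hy

lemma diag_eq_diag_iff (s : ℕ) (ω ω' : Ω) :
    diag X s ω' = diag X s ω ↔ ∀ y < s, X (s - y) (y + 1) ω' = X (s - y) (y + 1) ω := by
  rw [funext_iff]
  refine forall_congr' fun y => ?_
  simp only [diag, diagLink, Nat.succ_le_iff, Nat.add_sub_add_right, Nat.cast_add, Nat.cast_one]
  split_ifs with h <;> simp [h]

/-- The states of the links `1, …, t` at the times `1, …, t`. -/
def pattern (X : ℕ → ℤ → Ω → Bool) (t : ℕ) (ω : Ω) : Fin t → Fin t → Bool :=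
  fun y s => X (s + 1) (y + 1) ω

lemma eq_of_pattern_eq {t : ℕ} {ω ω' : Ω} (h : pattern X t ω = pattern X t ω') {y s : ℕ}
    (hy : y < t) (hs : 1 ≤ s) (hst : s ≤ t) : X s (y + 1) ω = X s (y + 1) ω' := by
  have := congr_fun (congr_fun h ⟨y, hy⟩) ⟨s - 1, by omega⟩
  simpa [pattern, Nat.sub_add_cancel hs] using this

lemma msg_factorsThrough_pattern {s t : ℕ} (hst : s ≤ t) :
    (msg X s).FactorsThrough (pattern X t) := by
  intro ω ω' h
  exact (msg_eq_msg_iff s ω' ω).2 fun y hy _ => eq_of_pattern_eq h (by omega) (by omega) (by omega)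

lemma pastMsgs_factorsThrough_pattern (t n : ℕ) :
    (pastMsgs X t n).FactorsThrough (pattern X t) := by
  intro ω ω' h
  funext i
  exact msg_factorsThrough_pattern (Nat.sub_le _ _) h

lemma diag_factorsThrough_pattern {s t : ℕ} (hst : s ≤ t) :
    (diag X s).FactorsThrough (pattern X t) := by
  intro ω ω' h
  exact (diag_eq_diag_iff s ω' ω).2 fun y hy =>
    eq_of_pattern_eq h (by omega) (by omega) (by omega)

/-! ### Observations of the links at random lags -/

/-- `F` observes exactly, for each link `y + 1`, the states `i` time units before `t - y`, for
the lags `i` in a random set `S ω y`. -/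
structure ObservesLinks {β : Type*} (X : ℕ → ℤ → Ω → Bool) (t : ℕ) (F : Ω → β)
    (S : Ω → ℕ → Finset ℕ) : Prop where
  bounds : ∀ ω y, ∀ i ∈ S ω y, 1 ≤ i ∧ i < t - y
  eq_iff : ∀ ω ω', F ω' = F ω ↔
    ∀ y < t, ∀ i ∈ S ω y, X (t - y - i) (y + 1) ω' = X (t - y - i) (y + 1) ω

/-- The lags at which the link `y + 1` is revealed by `M_{t-1}, …, M_{t-n}`. -/
def upperLags (X : ℕ → ℤ → Ω → Bool) (n t : ℕ) (ω : Ω) (y : ℕ) : Finset ℕ :=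
  (Finset.Icc 1 n).filter fun i => i < t - y ∧ y ≤ msg X (t - i) ω

/-- The lags at which the link `y + 1` is revealed by `M_{t-1}, …, M_{t-n}` and `Z_{t-n-1}`. -/
def lowerLags (X : ℕ → ℤ → Ω → Bool) (n t : ℕ) (ω : Ω) (y : ℕ) : Finset ℕ :=
  (Finset.Icc 1 (n + 1)).filter fun i => i < t - y ∧ (i = n + 1 ∨ y ≤ msg X (t - i) ω)

lemma upperLags_factorsThrough_pattern (n t y : ℕ) :
    (upperLags X n t · y).FactorsThrough (pattern X t) := by
  intro ω ω' h
  simp only [upperLags]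
  congr 1
  funext i
  rw [msg_factorsThrough_pattern (Nat.sub_le t i) h]

lemma lowerLags_factorsThrough_pattern (n t y : ℕ) :
    (lowerLags X n t · y).FactorsThrough (pattern X t) := by
  intro ω ω' h
  simp only [lowerLags]
  congr 1
  funext i
  rw [msg_factorsThrough_pattern (Nat.sub_le t i) h]

lemma pastMsgs_eq_pastMsgs_iff (t n : ℕ) (ω ω' : Ω) :
    pastMsgs X t n ω' = pastMsgs X t n ω ↔
      ∀ y < t, ∀ i, 1 ≤ i → i ≤ n → i < t - y → y ≤ msg X (t - i) ω →
        X (t - y - i) (y + 1) ω' = X (t - y - i) (y + 1) ω := by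
  simp only [funext_iff, pastMsgs, msg_eq_msg_iff]
  constructor
  · intro h y _ i hi1 hin hit hle
    have := h ⟨i - 1, by omega⟩ y (by simp only; omega)
      (by simpa only [Nat.sub_add_cancel hi1] using hle)
    simpa only [Nat.sub_add_cancel hi1, Nat.sub_right_comm t i y] using this
  · intro h i y hy hle
    have := h y (by omega) (i + 1) (by omega) (by omega) (by omega) hle
    rwa [Nat.sub_right_comm] at this

lemma observesLinks_pastMsgs (n t : ℕ) :
    ObservesLinks X t (pastMsgs X t n) (upperLags X n t) where
  bounds ω y i hi := by
    simp only [upperLags, Finset.mem_filter, Finset.mem_Icc] at hi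
    omega
  eq_iff ω ω' := by
    rw [pastMsgs_eq_pastMsgs_iff]
    simp only [upperLags, Finset.mem_filter, Finset.mem_Icc, and_imp]

/-- The lag `n + 1` comes from `Z_{t-n-1}` and needs no condition on the messages. -/
lemma observesLinks_pastMsgs_diag (n t : ℕ) :
    ObservesLinks X t (fun ω => (pastMsgs X t n ω, diag X (t - (n + 1)) ω))
      (lowerLags X n t) where
  bounds ω y i hi := by
    simp only [lowerLags, Finset.mem_filter, Finset.mem_Icc] at hi
    omega
  eq_iff ω ω' := by
    rw [Prod.mk.injEq, pastMsgs_eq_pastMsgs_iff, diag_eq_diag_iff]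
    simp only [lowerLags, Finset.mem_filter, Finset.mem_Icc, and_imp]
    constructor
    · rintro ⟨h1, h2⟩ y hy i hi1 hin hit hor
      rcases eq_or_ne i (n + 1) with rfl | hne
      · rw [Nat.sub_right_comm]
        exact h2 y (by omega)
      · exact h1 y hy i hi1 (by omega) hit (hor.resolve_left hne)
    · intro h
      refine ⟨fun y hy i hi1 hin hit hle => h y hy i hi1 (by omega) hit (Or.inr hle),
        fun y hy => ?_⟩
      rw [Nat.sub_right_comm]
      exact h y (by omega) (n + 1) (by omega) le_rfl (by omega) (Or.inl rfl)

end Messages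

end LinkNetwork

end

noncomputable section

namespace LinkNetwork

/-! ### Trajectories, losses and records -/

section Path

variable {Ω : Type*} {X : ℕ → ℤ → Ω → Bool}

/-- The trajectory of the link `y + 1`. -/
def traj (X : ℕ → ℤ → Ω → Bool) (y : ℕ) (ω : Ω) (s : ℕ) : Bool := X (s + 1) (y + 1) ω

/-- The log-loss of predicting the link `y + 1` at time `t - y` from its state `i` steps
earlier. -/
def logLoss (u d : ℝ) (X : ℕ → ℤ → Ω → Bool) (t y i : ℕ) (ω : Ω) : ℝ :=
  -Real.log (lagProb u d i (X (t - y - i) (y + 1) ω) (X (t - y) (y + 1) ω))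

/-- The log-loss incurred at link `y + 1` if the message reaches it. -/
def msgLoss (u d : ℝ) (X : ℕ → ℤ → Ω → Bool) (t : ℕ) (S : Ω → ℕ → Finset ℕ) (y : ℕ) (ω : Ω) : ℝ :=
  if y ≤ msg X t ω then logLoss u d X t y (sInf (S ω y : Set ℕ)) ω else 0

lemma msgLoss_factorsThrough {β : Type*} {t : ℕ} {F : Ω → β} {S : Ω → ℕ → Finset ℕ} {u d : ℝ}
    (hF : ObservesLinks X t F S) {y : ℕ} (hy : y < t)
    (hS : (S · y).FactorsThrough (pattern X t)) :
    (msgLoss u d X t S y).FactorsThrough (pattern X t) := by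
  intro ω ω' h
  have h0 : S ω y = S ω' y := hS h
  have hlt : sInf (S ω' y : Set ℕ) < t - y := by
    rcases (S ω' y).eq_empty_or_nonempty with h' | h'
    · simp [h']; omega
    · have hmem : sInf (S ω' y : Set ℕ) ∈ S ω' y := by
        exact_mod_cast Nat.sInf_mem (s := (S ω' y : Set ℕ)) h'
      exact (hF.bounds ω' y _ hmem).2
  rw [msgLoss, msgLoss, logLoss, logLoss, h0, msg_factorsThrough_pattern le_rfl h,
    eq_of_pattern_eq h hy (by omega) (by omega), eq_of_pattern_eq h hy (by omega) (by omega)]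

/-- The event `M_{t-1}, …, M_{t-n} < m ≤ M_t`. -/
def recordEvent (X : ℕ → ℤ → Ω → Bool) (n t m : ℕ) : Set Ω :=
  {ω | m ≤ msg X t ω ∧ ∀ i ∈ Finset.Icc 1 n, msg X (t - i) ω < m}

/-- Whether a message is at least `m` depends on the first `m` links only. This makes the event
independent of the link `m + 1`, whose trajectory is `traj X m`. -/
lemma recordEvent_eq_preimage {n t m : ℕ} (h : m + n ≤ t) :
    ∃ G : Set (Finset.range m → ℕ → Bool), MeasurableSet G ∧
      recordEvent X n t m = (fun ω (y : Finset.range m) => traj X y ω) ⁻¹' G := by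
  have hev : ∀ q : ℕ, MeasurableSet
      {f : Finset.range m → ℕ → Bool | ∀ y, f y (q - y - 1) = true} := by
    intro q
    have : {f : Finset.range m → ℕ → Bool | ∀ y, f y (q - y - 1) = true} =
        ⋂ y : Finset.range m, (fun f : Finset.range m → ℕ → Bool => f y (q - y - 1)) ⁻¹' {true} := by
      ext f; simp
    rw [this]
    exact MeasurableSet.iInter fun y =>
      (by fun_prop : Measurable fun f : Finset.range m → ℕ → Bool => f y (q - y - 1))
        (measurableSet_singleton _)
  have hmsg : ∀ q, m ≤ q → ∀ ω, m ≤ msg X q ω ↔ (fun y : Finset.range m => traj X y ω) ∈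
      {f : Finset.range m → ℕ → Bool | ∀ y, f y (q - y - 1) = true} := by
    intro q hq ω
    simp only [le_msg_iff, hq, true_and, Set.mem_ofPred_eq, Subtype.forall, Finset.mem_range, traj]
    refine forall₂_congr fun y hy => ?_
    rw [Nat.sub_add_cancel (by omega)]
  refine ⟨{f | ∀ y, f y (t - y - 1) = true} ∩
    ⋂ i ∈ Finset.Icc 1 n, {f | ∀ y, f y (t - i - y - 1) = true}ᶜ,
    (hev t).inter (Finset.measurableSet_biInter _ fun i _ => (hev (t - i)).compl), ?_⟩
  ext ω
  simp only [recordEvent, Set.mem_ofPred_eq, Set.mem_preimage, Set.mem_inter_iff, Set.mem_iInter,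
    Set.mem_compl_iff]
  rw [hmsg t (by omega)]
  refine and_congr Iff.rfl (forall₂_congr fun i hi => ?_)
  rw [Finset.mem_Icc] at hi
  rw [← not_le, hmsg (t - i) (by omega)]
  rfl

end Path

variable {Ω : Type*} [MeasurableSpace Ω] {μ : Measure Ω} {u d : ℝ} {X : ℕ → ℤ → Ω → Bool}

/-! ### Independence of the links -/

lemma IsLinkNetwork.measurable_traj (hX : IsLinkNetwork u d μ X) (y : ℕ) :
    Measurable (traj X y) :=
  measurable_pi_lambda _ fun s => hX.measurable (s + 1) (by omega) _

lemma IsLinkNetwork.iIndepFun_traj (hX : IsLinkNetwork u d μ X) : iIndepFun (traj X) μ :=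
  hX.indep.precomp (g := fun y : ℕ => (y : ℤ) + 1) fun y z h => by simpa using h

lemma IsLinkNetwork.indepFun_traj (hX : IsLinkNetwork u d μ X) (m : ℕ) :
    IndepFun (fun ω (y : Finset.range m) => traj X y ω) (traj X m) μ := by
  have h := hX.iIndepFun_traj.indepFun_finset (Finset.range m) {m} (by simp) hX.measurable_traj
  exact h.comp measurable_id
    (measurable_pi_apply (⟨m, Finset.mem_singleton_self m⟩ : ({m} : Finset ℕ)))

lemma IsLinkNetwork.measurable_pattern (hX : IsLinkNetwork u d μ X) (t : ℕ) :
    Measurable (pattern X t) :=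
  measurable_pi_lambda _ fun _ => measurable_pi_lambda _ fun _ => hX.measurable _ (by omega) _

lemma IsLinkNetwork.measureReal_forall_traj (hX : IsLinkNetwork u d μ X) (n : ℕ)
    (B : ℕ → Set (ℕ → Bool)) (hB : ∀ y, MeasurableSet (B y)) :
    μ.real {ω | ∀ y < n, traj X y ω ∈ B y} =
      ∏ y ∈ Finset.range n, μ.real {ω | traj X y ω ∈ B y} := by
  have h := hX.iIndepFun_traj.measure_inter_preimage_eq_mul (Finset.range n) (sets := B)
    fun y _ => hB y
  have hset : {ω | ∀ y < n, traj X y ω ∈ B y} =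
      ⋂ y ∈ Finset.range n, traj X y ⁻¹' B y := by
    ext ω; simp
  rw [hset, measureReal_def, h, ENNReal.toReal_prod]
  rfl

lemma measurableSet_forall_coord (T : Finset ℕ) (a : ℕ → Bool) :
    MeasurableSet {f : ℕ → Bool | ∀ s ∈ T, f (s - 1) = a s} := by
  have : {f : ℕ → Bool | ∀ s ∈ T, f (s - 1) = a s} =
      ⋂ s ∈ T, (fun f : ℕ → Bool => f (s - 1)) ⁻¹' {a s} := by
    ext f; simp
  rw [this]
  exact Finset.measurableSet_biInter _ fun s _ =>
    measurable_pi_apply (s - 1) (measurableSet_singleton _)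

lemma IsLinkNetwork.measureReal_forall_linkEvent (hX : IsLinkNetwork u d μ X) (n : ℕ)
    (T : ℕ → Finset ℕ) (hT : ∀ y, ∀ s ∈ T y, 1 ≤ s) (a : ℕ → ℕ → Bool) :
    μ.real {ω | ∀ y < n, ω ∈ linkEvent X (y + 1) (T y) (a y)} =
      ∏ y ∈ Finset.range n, μ.real (linkEvent X (y + 1) (T y) (a y)) := by
  have key : ∀ y : ℕ, ∀ ω, ω ∈ linkEvent X (y + 1) (T y) (a y) ↔
      traj X y ω ∈ {f : ℕ → Bool | ∀ s ∈ T y, f (s - 1) = a y s} := by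
    intro y ω
    refine forall₂_congr fun s hs => ?_
    rw [traj, Nat.sub_add_cancel (hT y s hs)]
  have h := hX.measureReal_forall_traj n
    (fun y => {f : ℕ → Bool | ∀ s ∈ T y, f (s - 1) = a y s})
    fun y => measurableSet_forall_coord _ _
  simp only [← key] at h
  exact h

/-! ### The conditional law of a message -/

section Prediction

variable [IsProbabilityMeasure μ] {β : Type*} {t : ℕ} {F : Ω → β} {S : Ω → ℕ → Finset ℕ}

/-- Both events prescribe states link by link, so independence makes both probabilities products;
their ratio is the product of the one-link predictions. -/
lemma IsLinkNetwork.measureReal_msg_and (hX : IsLinkNetwork u d μ X)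
    (hu : u ∈ Set.Ioo (0 : ℝ) 1) (hd : d ∈ Set.Ioo (0 : ℝ) 1)
    (hF : ObservesLinks X t F S) (ω : Ω) :
    0 < μ.real {ω' | F ω' = F ω} ∧
    μ.real {ω' | msg X t ω' = msg X t ω ∧ F ω' = F ω} = μ.real {ω' | F ω' = F ω} *
      ∏ y ∈ Finset.range t, if y ≤ msg X t ω then
        lagProb u d (sInf (S ω y : Set ℕ))
          (X (t - y - sInf (S ω y : Set ℕ)) (y + 1) ω) (X (t - y) (y + 1) ω) else 1 := by
  set T : ℕ → Finset ℕ := fun y => (S ω y).image (t - y - ·) with hTdef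
  -- Knowing `M_t` in addition adds the time `t - y` for exactly the links that the message reaches.
  set T' : ℕ → Finset ℕ := fun y =>
    if y ≤ msg X t ω ∧ y < t then insert (t - y) (T y) else T y with hTdef'
  have hT : ∀ y, ∀ s ∈ T y, 1 ≤ s := by
    intro y s hs
    obtain ⟨i, hi, rfl⟩ := Finset.mem_image.1 hs
    have := hF.bounds ω y i hi
    omega
  have hT' : ∀ y, ∀ s ∈ T' y, 1 ≤ s := by
    intro y s hs
    simp only [hTdef'] at hs
    split_ifs at hs with h
    · rcases Finset.mem_insert.1 hs with rfl | hs
      · omega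
      · exact hT y s hs
    · exact hT y s hs
  set a : ℕ → ℕ → Bool := fun y s => X s (y + 1) ω
  have h1 : {ω' | F ω' = F ω} = {ω' | ∀ y < t, ω' ∈ linkEvent X (y + 1) (T y) (a y)} := by
    ext ω'
    simp only [Set.mem_ofPred_eq, hF.eq_iff ω ω', linkEvent, hTdef, Finset.forall_mem_image, a]
  have h2 : {ω' | msg X t ω' = msg X t ω ∧ F ω' = F ω} =
      {ω' | ∀ y < t, ω' ∈ linkEvent X (y + 1) (T' y) (a y)} := by
    ext ω'
    simp only [Set.mem_ofPred_eq, hF.eq_iff ω ω', linkEvent, hTdef', hTdef, msg_eq_msg_iff, a]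
    rw [← forall₂_and]
    refine forall₂_congr fun y hy => ?_
    split_ifs with h
    · simp [h.1]
    · simp [hy] at h
      simp [h]
  rw [h1, h2, hX.measureReal_forall_linkEvent t T hT a, hX.measureReal_forall_linkEvent t T' hT' a]
  refine ⟨Finset.prod_pos fun y _ => hX.measureReal_linkEvent_pos hu hd _ (hT y) _, ?_⟩
  rw [← Finset.prod_mul_distrib]
  refine Finset.prod_congr rfl fun y hy => ?_
  have hyt := Finset.mem_range.1 hy
  simp only [hTdef', hyt, and_true]
  split_ifs with h
  · exact hX.measureReal_linkEvent_insert hu hd _ (by omega) (S ω y) (hF.bounds ω y) (a y)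
  · rw [mul_one]

lemma IsLinkNetwork.integrable_msgLoss (hX : IsLinkNetwork u d μ X) (hF : ObservesLinks X t F S)
    {y : ℕ} (hy : y < t) (hS : (S · y).FactorsThrough (pattern X t)) :
    Integrable (msgLoss u d X t S y) μ :=
  integrable_of_factorsThrough (hX.measurable_pattern t) (msgLoss_factorsThrough hF hy hS)

/-- The logarithm of the product prediction is a sum of one-link losses. -/
lemma IsLinkNetwork.condEntropy_msg (hX : IsLinkNetwork u d μ X)
    (hu : u ∈ Set.Ioo (0 : ℝ) 1) (hd : d ∈ Set.Ioo (0 : ℝ) 1)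
    (hF : ObservesLinks X t F S) (hFp : F.FactorsThrough (pattern X t))
    (hS : ∀ y, (S · y).FactorsThrough (pattern X t)) :
    condEntropy μ (msg X t) F = ∑ y ∈ Finset.range t, ∫ ω, msgLoss u d X t S y ω ∂μ := by
  rw [condEntropy_eq_integral (hX.measurable_pattern t) (msg_factorsThrough_pattern le_rfl) hFp,
    ← integral_finsetSum _ fun y hy =>
      hX.integrable_msgLoss hF (Finset.mem_range.1 hy) (hS y)]
  congr 1
  funext ω
  obtain ⟨hpos, heq⟩ := hX.measureReal_msg_and hu hd hF ω
  rw [heq, mul_div_cancel_left₀ _ hpos.ne', Real.log_prod, ← Finset.sum_neg_distrib]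
  · refine Finset.sum_congr rfl fun y _ => ?_
    rw [msgLoss, logLoss]
    split_ifs <;> simp
  · intro y _
    split_ifs
    · exact (lagProb_pos hu hd _ _ _).ne'
    · exact one_ne_zero

end Prediction

/-! ### The mean log-loss -/

/-- The conditional entropy of a stationary link given its state `i` steps earlier (given nothing
if `i = 0`). -/
def linkEntropy (u d : ℝ) (i : ℕ) : ℝ :=
  ∑ a, ∑ b, statProb u d a * lagProb u d i a b * -Real.log (lagProb u d i a b)

lemma IsLinkNetwork.measurableSet_recordEvent (hX : IsLinkNetwork u d μ X) {n t m : ℕ}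
    (h : m + n ≤ t) : MeasurableSet (recordEvent X n t m) := by
  obtain ⟨G, hG, hEq⟩ := recordEvent_eq_preimage (X := X) h
  rw [hEq]
  exact (measurable_pi_lambda _ fun y => hX.measurable_traj _) hG

lemma IsLinkNetwork.measureReal_recordEvent_inter (hX : IsLinkNetwork u d μ X) {n t m : ℕ}
    (h : m + n ≤ t) {B : Set (ℕ → Bool)} (hB : MeasurableSet B) :
    μ.real (recordEvent X n t m ∩ traj X m ⁻¹' B) =
      μ.real (recordEvent X n t m) * μ.real (traj X m ⁻¹' B) := by
  obtain ⟨G, hG, hEq⟩ := recordEvent_eq_preimage (X := X) h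
  rw [hEq, measureReal_def, (hX.indepFun_traj m).measure_inter_preimage_eq_mul G B hG hB,
    ENNReal.toReal_mul]
  rfl

section Mean

variable [IsProbabilityMeasure μ]

lemma IsLinkNetwork.integral_neg_log_lagProb (hX : IsLinkNetwork u d μ X)
    (hu : u ∈ Set.Ioo (0 : ℝ) 1) (hd : d ∈ Set.Ioo (0 : ℝ) 1) (x : ℤ) {s : ℕ} (hs : 1 ≤ s)
    (i : ℕ) :
    ∫ ω, -Real.log (lagProb u d i (X s x ω) (X (s + i) x ω)) ∂μ = linkEntropy u d i := by
  have hm := hX.measurable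
  -- At lag `0` both times coincide, so the pair law does not apply; the first state in
  -- `linkEntropy` is then a dummy that sums out.
  rcases i with _ | i
  · simp only [add_zero]
    rw [integral_comp_fintype (hm s hs x) (fun b => -Real.log (lagProb u d 0 b b)), linkEntropy,
      Finset.sum_comm]
    refine Finset.sum_congr rfl fun b _ => ?_
    have := hX.measureReal_state hu hd x hs (fun _ => b)
    simp only [linkEvent, Finset.mem_singleton, forall_eq] at this
    rw [this]
    simp only [lagProb, mul_assoc]
    rw [← Finset.sum_mul, sum_statProb hu hd, one_mul]
  · rw [integral_comp_fintype ((hm s hs x).prodMk (hm (s + (i + 1)) (by omega) x))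
      (fun p : Bool × Bool => -Real.log (lagProb u d (i + 1) p.1 p.2)), linkEntropy,
      Fintype.sum_prod_type]
    refine Finset.sum_congr rfl fun a _ => Finset.sum_congr rfl fun b _ => ?_
    rw [← hX.measureReal_pair hu hd x hs (by omega)]
    simp only [Prod.mk.injEq]

/-- The event depends on the first `m` links and the loss on the link `m + 1`, so the expectation
factors; stationarity gives the mean loss. -/
lemma IsLinkNetwork.integral_indicator_recordEvent (hX : IsLinkNetwork u d μ X)
    (hu : u ∈ Set.Ioo (0 : ℝ) 1) (hd : d ∈ Set.Ioo (0 : ℝ) 1) {n t m i : ℕ}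
    (h : m + n ≤ t) (hi : m + i < t) :
    ∫ ω, (recordEvent X n t m).indicator (logLoss u d X t m i) ω ∂μ =
      μ.real (recordEvent X n t m) * linkEntropy u d i := by
  obtain ⟨G, hG, hEq⟩ := recordEvent_eq_preimage (X := X) h
  set g : (ℕ → Bool) → ℝ := fun f => -Real.log (lagProb u d i (f (t - m - i - 1)) (f (t - m - 1)))
  have hg : Measurable g := by
    have h2 : Measurable fun f : ℕ → Bool => (f (t - m - i - 1), f (t - m - 1)) := by fun_prop
    exact (Measurable.of_discrete
      (f := fun p : Bool × Bool => -Real.log (lagProb u d i p.1 p.2))).comp h2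
  have hloss : ∀ ω, logLoss u d X t m i ω = g (traj X m ω) := by
    intro ω
    simp only [logLoss, g, traj]
    rw [Nat.sub_add_cancel (by omega), Nat.sub_add_cancel (by omega)]
  have hprod := (hX.indepFun_traj m).integral_fun_comp_mul_comp (f := G.indicator fun _ => (1 : ℝ))
    (g := g) (measurable_pi_lambda _ fun y => hX.measurable_traj _).aemeasurable
    (hX.measurable_traj m).aemeasurable
    (measurable_const.indicator hG).aestronglyMeasurable hg.aestronglyMeasurable
  have hmean : ∫ ω, g (traj X m ω) ∂μ = linkEntropy u d i := by
    rw [← hX.integral_neg_log_lagProb hu hd (m + 1) (s := t - m - i) (by omega) i]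
    simp only [← hloss, logLoss]
    rw [Nat.sub_add_cancel (by omega)]
  rw [hmean] at hprod
  have hind : ∀ ω, (recordEvent X n t m).indicator (logLoss u d X t m i) ω =
      G.indicator (fun _ => (1 : ℝ)) (fun y : Finset.range m => traj X y ω) * g (traj X m ω) := by
    intro ω
    rw [hEq, ← hloss]
    by_cases hω : (fun y : Finset.range m => traj X y ω) ∈ G
    · rw [Set.indicator_of_mem (by exact hω), Set.indicator_of_mem hω, one_mul]
    · rw [Set.indicator_of_notMem (by exact hω), Set.indicator_of_notMem hω, zero_mul]
  simp_rw [hind]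
  rw [hprod]
  congr 1
  rw [← integral_indicator_one (hX.measurableSet_recordEvent h), hEq]
  rfl

end Mean

end LinkNetwork

end

noncomputable section

namespace LinkNetwork

lemma exists_abs_log_lagProb_le (u d : ℝ) (J : ℕ) :
    ∃ C, 0 ≤ C ∧ ∀ i ≤ J, ∀ a b, |Real.log (lagProb u d i a b)| ≤ C := by
  have h0 : ∀ i a b, 0 ≤ |Real.log (lagProb u d i a b)| := fun _ _ _ => abs_nonneg _
  refine ⟨∑ i ∈ Finset.range (J + 1), ∑ a, ∑ b, |Real.log (lagProb u d i a b)|,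
    Finset.sum_nonneg fun i _ => Finset.sum_nonneg fun a _ => Finset.sum_nonneg fun b _ => h0 i a b,
    fun i hi a b => ?_⟩
  refine le_trans ?_ (Finset.single_le_sum (fun i _ => Finset.sum_nonneg fun a _ =>
    Finset.sum_nonneg fun b _ => h0 i a b) (Finset.mem_range.2 (Nat.lt_succ_of_le hi)))
  refine le_trans ?_ (Finset.single_le_sum (fun a _ =>
    Finset.sum_nonneg fun b _ => h0 i a b) (Finset.mem_univ a))
  exact Finset.single_le_sum (fun b _ => h0 i a b) (Finset.mem_univ b)

variable {Ω : Type*} [MeasurableSpace Ω] {μ : Measure Ω}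
  {u d : ℝ} {X : ℕ → ℤ → Ω → Bool}

/-! ### Probabilities of records -/

lemma IsLinkNetwork.measurableSet_of_factorsThrough (hX : IsLinkNetwork u d μ X) (t : ℕ)
    {p : Ω → Prop} (hp : p.FactorsThrough (pattern X t)) : MeasurableSet {ω | p ω} :=
  measurableSet_setOfPred.2 (measurable_of_factorsThrough (hX.measurable_pattern t) hp)

lemma IsLinkNetwork.measurableSet_le_msg (hX : IsLinkNetwork u d μ X) (t m : ℕ) :
    MeasurableSet {ω | m ≤ msg X t ω} :=
  hX.measurableSet_of_factorsThrough t fun ω ω' h => by rw [msg_factorsThrough_pattern le_rfl h]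

variable [IsProbabilityMeasure μ]

lemma IsLinkNetwork.measureReal_le_msg_of_le (hX : IsLinkNetwork u d μ X)
    (hu : u ∈ Set.Ioo (0 : ℝ) 1) (hd : d ∈ Set.Ioo (0 : ℝ) 1) {t m : ℕ} (h : m ≤ t) :
    μ.real {ω | m ≤ msg X t ω} = upProb u d ^ m := by
  -- Truncating at `t - 1` keeps the prescribed times positive for every `y`, as the independence
  -- lemma requires, and changes nothing for `y < m`.
  have h1 : {ω | m ≤ msg X t ω} =
      {ω | ∀ y < m, ω ∈ linkEvent X (y + 1) {t - min y (t - 1)} (fun _ => true)} := by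
    ext ω
    simp only [Set.mem_ofPred_eq, le_msg_iff, h, true_and, linkEvent, Finset.mem_singleton,
      forall_eq]
    refine forall₂_congr fun y hy => ?_
    rw [min_eq_left (by omega)]
  rcases m with _ | m
  · simp
  rw [h1, hX.measureReal_forall_linkEvent (m + 1) (fun y => {t - min y (t - 1)})
    (by intro y s hs; rw [Finset.mem_singleton.1 hs]; omega) (fun _ _ => true)]
  rw [Finset.prod_congr rfl fun y _ => hX.measureReal_state hu hd _ (by omega) _]
  simp [statProb]

lemma upProb_pos (hu : u ∈ Set.Ioo (0 : ℝ) 1) (hd : d ∈ Set.Ioo (0 : ℝ) 1) : 0 < upProb u d :=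
  statProb_pos hu hd true

lemma downProb_pos (hu : u ∈ Set.Ioo (0 : ℝ) 1) (hd : d ∈ Set.Ioo (0 : ℝ) 1) :
    0 < downProb u d :=
  statProb_pos hu hd false

lemma upProb_lt_one (hu : u ∈ Set.Ioo (0 : ℝ) 1) (hd : d ∈ Set.Ioo (0 : ℝ) 1) :
    upProb u d < 1 := by
  linarith [upProb_add_downProb hu hd, downProb_pos hu hd]

lemma IsLinkNetwork.measureReal_le_msg_le (hX : IsLinkNetwork u d μ X)
    (hu : u ∈ Set.Ioo (0 : ℝ) 1) (hd : d ∈ Set.Ioo (0 : ℝ) 1) (t m : ℕ) :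
    μ.real {ω | m ≤ msg X t ω} ≤ upProb u d ^ m := by
  rcases le_or_gt m t with h | h
  · exact (hX.measureReal_le_msg_of_le hu hd h).le
  · have : {ω | m ≤ msg X t ω} = ∅ := by
      ext ω
      have := msg_le (X := X) t ω
      simp only [Set.mem_ofPred_eq, Set.mem_empty_iff_false, iff_false]
      omega
    rw [this]
    simpa using pow_nonneg (upProb_pos hu hd).le m

/-- The record probabilities do not depend on the time once it is large enough. -/
lemma IsLinkNetwork.measureReal_recordEvent_eq (hX : IsLinkNetwork u d μ X)
    (hu : u ∈ Set.Ioo (0 : ℝ) 1) (hd : d ∈ Set.Ioo (0 : ℝ) 1) {n t m : ℕ} (h : m + n ≤ t) :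
    μ.real (recordEvent X n t m) = μ.real (recordEvent X n (m + n) m) := by
  -- The event is a fixed function of the states of each link `y + 1`, `y < m`, in the window from
  -- `t - n - y` to `t - y`; by stationarity the law of these windows is independent of `t`.
  set W : ℕ → Ω → Fin m → Fin (n + 1) → Bool :=
    fun t ω y i => X (t - n - y + 1 * i) (y + 1) ω with hW
  have hWm : ∀ t, m + n ≤ t → Measurable (W t) := fun t ht =>
    measurable_pi_lambda _ fun y => measurable_pi_lambda _ fun i =>
      hX.measurable _ (by have := y.2; omega) _
  set G : Set (Fin m → Fin (n + 1) → Bool) :=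
    {w | (∀ y, w y ⟨n, by omega⟩ = true) ∧
      ∀ i ∈ Finset.Icc 1 n, ¬ ∀ y, w y ⟨n - i, by omega⟩ = true} with hG
  have hpre : ∀ t, m + n ≤ t → recordEvent X n t m = W t ⁻¹' G := by
    intro t ht
    ext ω
    simp only [recordEvent, hG, hW, Set.mem_ofPred_eq, Set.mem_preimage, le_msg_iff, ← not_le,
      one_mul, Fin.forall_iff]
    refine and_congr ?_ (forall₂_congr fun i hi => not_congr ?_)
    · rw [and_iff_right (by omega)]
      refine forall₂_congr fun y hy => ?_
      rw [show t - n - y + n = t - y by omega]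
    · rw [Finset.mem_Icc] at hi
      rw [and_iff_right (by omega)]
      refine forall₂_congr fun y hy => ?_
      rw [show t - n - y + (n - i) = t - i - y by omega]
  have hlaw : ∀ t, m + n ≤ t → ∀ w, μ.real (W t ⁻¹' {w}) =
      ∏ y : Fin m, (statProb u d (w y ⟨0, by omega⟩) * ∏ i ∈ Finset.range n,
        lagProb u d 1 (w y (Fin.ofNat (n + 1) i)) (w y (Fin.ofNat (n + 1) (i + 1)))) := by
    intro t ht w
    set T : ℕ → Finset ℕ := fun y => (Finset.range (n + 1)).image (max 1 (t - n - y) + 1 * ·)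
    set a : ℕ → ℕ → Bool := fun y s =>
      if hy : y < m then w ⟨y, hy⟩ (Fin.ofNat (n + 1) (s - (t - n - y))) else false
    have hval : ∀ y : Fin m, ∀ ω, ω ∈ linkEvent X ((y : ℕ) + 1) (T y) (a y) ↔
        ∀ i < n + 1, X (t - n - y + 1 * i) (y + 1) ω = w y (Fin.ofNat (n + 1) i) := by
      intro y ω
      have hym := y.2
      simp only [linkEvent, T, Finset.forall_mem_image, Set.mem_ofPred_eq, Finset.mem_range]
      refine forall₂_congr fun i hi => ?_
      rw [max_eq_right (by omega)]
      simp only [a, hym, dif_pos, one_mul, Nat.add_sub_cancel_left]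
    have hset : W t ⁻¹' {w} = {ω | ∀ y < m, ω ∈ linkEvent X (y + 1) (T y) (a y)} := by
      ext ω
      simp only [Set.mem_preimage, Set.mem_singleton_iff, funext_iff, Set.mem_ofPred_eq]
      rw [← Fin.forall_iff (p := fun y : Fin m => ω ∈ linkEvent X ((y : ℕ) + 1) (T y) (a y))]
      refine forall_congr' fun y => ?_
      rw [hval, Fin.forall_iff]
      refine forall₂_congr fun i hi => ?_
      simp only [hW]
      rw [show (⟨i, hi⟩ : Fin (n + 1)) = Fin.ofNat (n + 1) i from
        Fin.ext (Nat.mod_eq_of_lt hi).symm]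
    rw [hset, hX.measureReal_forall_linkEvent m T ?_ a, ← Fin.prod_univ_eq_prod_range
      (fun y => μ.real (linkEvent X ((y : ℕ) + 1) (T y) (a y)))]
    · refine Finset.prod_congr rfl fun y _ => ?_
      have hym := y.2
      have := hX.measureReal_path hu hd (y + 1) (s := t - n - y) (j := 1) (by omega) le_rfl n
        (fun i => w y (Fin.ofNat (n + 1) i))
      rw [show linkEvent X ((y : ℕ) + 1) (T y) (a y) = _ from Set.ext (hval y)]
      exact this
    · intro y s hs
      obtain ⟨i, hi, rfl⟩ := Finset.mem_image.1 hs
      omega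
  have hmap : μ.map (W t) = μ.map (W (m + n)) := by
    refine Measure.ext_of_singleton fun w => ?_
    rw [Measure.map_apply (hWm t h) (measurableSet_singleton w),
      Measure.map_apply (hWm _ le_rfl) (measurableSet_singleton w)]
    have := (hlaw t h w).trans (hlaw _ le_rfl w).symm
    exact (measureReal_eq_measureReal_iff).1 this
  have hGm : MeasurableSet G := (Set.toFinite G).measurableSet
  rw [hpre t h, hpre _ le_rfl, measureReal_def, measureReal_def, ← Measure.map_apply (hWm t h) hGm,
    ← Measure.map_apply (hWm _ le_rfl) hGm, hmap]

/-- The eventual value of `P[M_{t-1}, …, M_{t-n} < m ≤ M_t]`. -/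
def recordTail (μ : Measure Ω) (X : ℕ → ℤ → Ω → Bool) (n m : ℕ) : ℝ :=
  μ.real (recordEvent X n (m + n) m)

lemma IsLinkNetwork.recordTail_zero (hX : IsLinkNetwork u d μ X)
    (hu : u ∈ Set.Ioo (0 : ℝ) 1) (hd : d ∈ Set.Ioo (0 : ℝ) 1) (m : ℕ) :
    recordTail μ X 0 m = upProb u d ^ m := by
  rw [← hX.measureReal_le_msg_of_le hu hd (t := m + 0) (by omega), recordTail]
  simp [recordEvent]

lemma IsLinkNetwork.tsum_recordTail_zero (hX : IsLinkNetwork u d μ X)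
    (hu : u ∈ Set.Ioo (0 : ℝ) 1) (hd : d ∈ Set.Ioo (0 : ℝ) 1) :
    ∑' m, recordTail μ X 0 m = 1 / downProb u d := by
  simp_rw [hX.recordTail_zero hu hd]
  rw [tsum_geometric_of_lt_one (upProb_pos hu hd).le (upProb_lt_one hu hd), one_div]
  congr 1
  linarith [upProb_add_downProb hu hd]

lemma summable_mul_upProb_pow (hu : u ∈ Set.Ioo (0 : ℝ) 1) (hd : d ∈ Set.Ioo (0 : ℝ) 1)
    (C : ℝ) : Summable fun y => C * upProb u d ^ y :=
  (summable_geometric_of_lt_one (upProb_pos hu hd).le (upProb_lt_one hu hd)).mul_left C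

/-- Split by the value `m` of `M_t`. The message equals `m` when it reaches `m` and the link `m + 1`
is down, which is independent of the first `m` links; this produces the factor `D`. -/
lemma IsLinkNetwork.tendsto_recordProb (hX : IsLinkNetwork u d μ X)
    (hu : u ∈ Set.Ioo (0 : ℝ) 1) (hd : d ∈ Set.Ioo (0 : ℝ) 1) (j : ℕ) :
    Tendsto (recordProb μ X j) atTop (𝓝 (downProb u d * ∑' m, recordTail μ X j m)) := by
  set f : ℕ → ℕ → ℝ := fun t m =>
    μ.real {ω | msg X t ω = m ∧ ∀ i ∈ Finset.Icc 1 j, msg X (t - i) ω < m}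
  have hmeas : ∀ t m, MeasurableSet
      {ω | msg X t ω = m ∧ ∀ i ∈ Finset.Icc 1 j, msg X (t - i) ω < m} := by
    intro t m
    refine hX.measurableSet_of_factorsThrough t fun ω ω' h => ?_
    simp only [msg_factorsThrough_pattern le_rfl h,
      fun i => msg_factorsThrough_pattern (Nat.sub_le t i) h]
  have hsum : ∀ t, recordProb μ X j t = ∑' m, f t m := by
    intro t
    rw [tsum_eq_sum (s := Finset.range (t + 1)), recordProb,
      ← measureReal_biUnion_finset _ fun m _ => hmeas t m]
    · congr 1
      ext ω
      have := msg_le (X := X) t ω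
      simp only [Set.mem_ofPred_eq, Set.mem_iUnion, Finset.mem_range, exists_prop]
      constructor
      · exact fun h => ⟨_, by omega, rfl, h⟩
      · rintro ⟨m, -, rfl, h⟩
        exact h
    · intro m _ m' _ hne
      refine Set.disjoint_left.2 fun ω h h' => hne ?_
      exact h.1.symm.trans h'.1
    · intro m hm
      have : {ω | msg X t ω = m ∧ ∀ i ∈ Finset.Icc 1 j, msg X (t - i) ω < m} = ∅ := by
        ext ω
        have := msg_le (X := X) t ω
        rw [Finset.mem_range] at hm
        simp only [Set.mem_ofPred_eq, Set.mem_empty_iff_false, iff_false]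
        omega
      simp only [f, this, measureReal_empty]
  have hval : ∀ m t, m + 1 + j ≤ t → f t m = downProb u d * recordTail μ X j m := by
    intro m t ht
    have hB : MeasurableSet {g : ℕ → Bool | g (t - m - 1) = false} :=
      (by fun_prop : Measurable fun g : ℕ → Bool => g (t - m - 1)) (measurableSet_singleton false)
    have h1 := hX.measureReal_recordEvent_inter (n := j) (t := t) (m := m) (by omega) hB
    have h2 : traj X m ⁻¹' {g : ℕ → Bool | g (t - m - 1) = false} =
        linkEvent X (m + 1) {t - m} (fun _ => false) := by
      ext ω
      simp [traj, linkEvent, Nat.sub_add_cancel (show 1 ≤ t - m by omega)]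
    rw [h2, hX.measureReal_state hu hd _ (by omega), hX.measureReal_recordEvent_eq hu hd
      (by omega), mul_comm] at h1
    rw [recordTail]
    refine Eq.trans ?_ h1
    refine congrArg μ.real (Set.ext fun ω => ?_)
    have hsucc : m + 1 ≤ msg X t ω ↔ m ≤ msg X t ω ∧ X (t - m) (m + 1) ω = true := by
      rw [le_msg_iff, le_msg_iff, Nat.forall_lt_succ_right]
      have h3 : m + 1 ≤ t := by omega
      have h4 : m ≤ t := by omega
      simp only [h3, h4, true_and]
    have heq : msg X t ω = m ↔ m ≤ msg X t ω ∧ X (t - m) (m + 1) ω = false := by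
      rw [← Bool.not_eq_true]
      constructor
      · intro h
        refine ⟨h.ge, fun h' => ?_⟩
        have := hsucc.2 ⟨h.ge, h'⟩
        omega
      · rintro ⟨h, h'⟩
        have := mt hsucc.1 (fun h'' => h' h''.2)
        omega
    simp only [Set.mem_ofPred_eq, heq, recordEvent, linkEvent, Set.mem_inter_iff,
      Finset.mem_singleton, forall_eq]
    tauto
  have hfun : recordProb μ X j = fun t => ∑' m, f t m := funext hsum
  rw [hfun, ← tsum_mul_left]
  refine tendsto_tsum_of_dominated_convergence (bound := fun m => 1 * upProb u d ^ m)
    (summable_mul_upProb_pow hu hd 1) (fun m => ?_) (Eventually.of_forall fun t m => ?_)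
  · refine tendsto_const_nhds.congr' ?_
    filter_upwards [eventually_ge_atTop (m + 1 + j)] with t ht
    exact (hval m t ht).symm
  · rw [Real.norm_of_nonneg measureReal_nonneg, one_mul]
    refine le_trans (measureReal_mono fun ω hω => ?_) (hX.measureReal_le_msg_le hu hd t m)
    exact hω.1.ge

end LinkNetwork

end

noncomputable section

namespace LinkNetwork

/-! ### Observations with bounded memory -/

section Observation

variable {Ω : Type*} {X : ℕ → ℤ → Ω → Bool}

/-- A sequence of observations of the links, one for each `t`, with bounded memory `J`. -/
structure IsObservation {β : ℕ → Type*} (X : ℕ → ℤ → Ω → Bool) (J : ℕ) (F : ∀ t, Ω → β t)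
    (S : ℕ → Ω → ℕ → Finset ℕ) : Prop where
  observes : ∀ t, ObservesLinks X t (F t) (S t)
  factors : ∀ t, (F t).FactorsThrough (pattern X t)
  lags_factor : ∀ t y, (S t · y).FactorsThrough (pattern X t)
  lags_le : ∀ t ω y, sInf (S t ω y : Set ℕ) ≤ J

lemma isObservation_pastMsgs (n : ℕ) :
    IsObservation X n (fun t => pastMsgs X t n) (upperLags X n) where
  observes t := observesLinks_pastMsgs n t
  factors t := pastMsgs_factorsThrough_pattern t n
  lags_factor t y := upperLags_factorsThrough_pattern n t y
  lags_le t ω y := by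
    rcases (upperLags X n t ω y).eq_empty_or_nonempty with h | h
    · simp [h]
    · have : sInf (upperLags X n t ω y : Set ℕ) ∈ upperLags X n t ω y := by
        exact_mod_cast Nat.sInf_mem (s := (upperLags X n t ω y : Set ℕ)) h
      exact (Finset.mem_Icc.1 (Finset.mem_filter.1 this).1).2

lemma isObservation_pastMsgs_diag (n : ℕ) :
    IsObservation X (n + 1) (fun t ω => (pastMsgs X t n ω, diag X (t - (n + 1)) ω))
      (lowerLags X n) where
  observes t := observesLinks_pastMsgs_diag n t
  factors t ω ω' h := Prod.ext (pastMsgs_factorsThrough_pattern t n h)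
    (diag_factorsThrough_pattern (Nat.sub_le _ _) h)
  lags_factor t y := lowerLags_factorsThrough_pattern n t y
  lags_le t ω y := by
    rcases (lowerLags X n t ω y).eq_empty_or_nonempty with h | h
    · simp [h]
    · have : sInf (lowerLags X n t ω y : Set ℕ) ∈ lowerLags X n t ω y := by
        exact_mod_cast Nat.sInf_mem (s := (lowerLags X n t ω y : Set ℕ)) h
      exact (Finset.mem_Icc.1 (Finset.mem_filter.1 this).1).2

/-! ### Lags of the upper and lower entropies -/

lemma exists_isLeast_lag {n t y : ℕ} {ω : Ω} (h : ∃ i ∈ Finset.Icc 1 n, y ≤ msg X (t - i) ω) :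
    ∃ i, 1 ≤ i ∧ i ≤ n ∧ y ≤ msg X (t - i) ω ∧
      ∀ k, 1 ≤ k → k ≤ n → y ≤ msg X (t - k) ω → i ≤ k := by
  classical
  have hex : ∃ i, 1 ≤ i ∧ i ≤ n ∧ y ≤ msg X (t - i) ω := by
    obtain ⟨i, hi, hy⟩ := h
    rw [Finset.mem_Icc] at hi
    exact ⟨i, hi.1, hi.2, hy⟩
  obtain ⟨h1, h2, h3⟩ := Nat.find_spec hex
  exact ⟨Nat.find hex, h1, h2, h3, fun k hk1 hkn hk => Nat.find_min' hex ⟨hk1, hkn, hk⟩⟩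

/-- The most recent message reaching the link decides. The diagonals contribute only the lags `n +
1` and `n + 2`, which are never smaller. -/
lemma sInf_lags_eq_of_exists {n t y : ℕ} {ω : Ω} (ht : y + n + 1 < t)
    (h : ∃ i ∈ Finset.Icc 1 (n + 1), y ≤ msg X (t - i) ω) :
    ∃ i, sInf (lowerLags X n t ω y : Set ℕ) = i ∧ sInf (lowerLags X (n + 1) t ω y : Set ℕ) = i ∧
      sInf (upperLags X (n + 1) t ω y : Set ℕ) = i := by
  obtain ⟨i, hi1, hin, hiy, hmin⟩ := exists_isLeast_lag h
  refine ⟨i, IsLeast.csInf_eq ⟨?_, fun k hk => ?_⟩, IsLeast.csInf_eq ⟨?_, fun k hk => ?_⟩,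
    IsLeast.csInf_eq ⟨?_, fun k hk => ?_⟩⟩
  all_goals
    simp only [lowerLags, upperLags, Finset.coe_filter, Finset.mem_Icc, Set.mem_ofPred_eq] at *
  · exact ⟨⟨hi1, hin⟩, by omega, Or.inr hiy⟩
  · rcases hk.2.2 with h' | h'
    · omega
    · exact hmin k hk.1.1 hk.1.2 h'
  · exact ⟨⟨hi1, by omega⟩, by omega, Or.inr hiy⟩
  · rcases hk.2.2 with h' | h'
    · omega
    · by_cases hkn : k ≤ n + 1
      · exact hmin k hk.1.1 hkn h'
      · omega
  · exact ⟨⟨hi1, hin⟩, by omega, hiy⟩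
  · exact hmin k hk.1.1 hk.1.2 hk.2.2

lemma sInf_lowerLags_eq {n t y : ℕ} {ω : Ω} (ht : y + n + 1 < t)
    (h : ∀ i ∈ Finset.Icc 1 n, msg X (t - i) ω < y) :
    sInf (lowerLags X n t ω y : Set ℕ) = n + 1 := by
  have : lowerLags X n t ω y = {n + 1} := by
    ext i
    simp only [lowerLags, Finset.mem_filter, Finset.mem_Icc, Finset.mem_singleton]
    constructor
    · rintro ⟨⟨h1, h2⟩, -, h3⟩
      by_contra hne
      have := h i (Finset.mem_Icc.2 ⟨h1, by omega⟩)
      omega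
    · rintro rfl
      exact ⟨⟨by omega, le_rfl⟩, by omega, Or.inl rfl⟩
  simp [this]

/-- The link is not revealed at all, and `sInf ∅ = 0` selects the stationary law. -/
lemma sInf_upperLags_eq {n t y : ℕ} {ω : Ω} (h : ∀ i ∈ Finset.Icc 1 n, msg X (t - i) ω < y) :
    sInf (upperLags X n t ω y : Set ℕ) = 0 := by
  have : upperLags X n t ω y = ∅ := by
    refine Finset.filter_eq_empty_iff.2 fun i hi hlt => ?_
    have := h i hi
    omega
  simp [this]

end Observation

variable {Ω : Type*} [MeasurableSpace Ω] {μ : Measure Ω} {u d : ℝ} {X : ℕ → ℤ → Ω → Bool}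

/-! ### The entropy of one link state -/

lemma linkEntropy_zero (hu : u ∈ Set.Ioo (0 : ℝ) 1) (hd : d ∈ Set.Ioo (0 : ℝ) 1) :
    linkEntropy u d 0 = Real.binEntropy (upProb u d) := by
  have h : 1 - upProb u d = downProb u d := by linarith [upProb_add_downProb hu hd]
  have hs := sum_statProb hu hd
  rw [Real.binEntropy_eq_negMulLog_add_negMulLog_one_sub, h, linkEntropy, Finset.sum_comm]
  simp only [lagProb, mul_assoc, ← Finset.sum_mul, hs, one_mul, Fintype.sum_bool]
  simp only [statProb, Real.negMulLog, mul_neg, neg_mul]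

lemma IsLinkNetwork.entropy_state (hX : IsLinkNetwork u d μ X)
    (hu : u ∈ Set.Ioo (0 : ℝ) 1) (hd : d ∈ Set.Ioo (0 : ℝ) 1) :
    entropy μ (X 1 1) = linkEntropy u d 0 := by
  have h : 1 - upProb u d = downProb u d := by linarith [upProb_add_downProb hu hd]
  rw [linkEntropy_zero hu hd, entropy, tsum_fintype, Fintype.sum_bool, hX.initial, hX.initial,
    Real.binEntropy_eq_negMulLog_add_negMulLog_one_sub, h]
  rfl

/-! ### Limits of conditional entropies -/

/-- The expected log-loss at link `y + 1`. -/
def meanLoss (μ : Measure Ω) (u d : ℝ) (X : ℕ → ℤ → Ω → Bool) (S : ℕ → Ω → ℕ → Finset ℕ)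
    (t y : ℕ) : ℝ :=
  if y < t then ∫ ω, msgLoss u d X t (S t) y ω ∂μ else 0

lemma summable_meanLoss {S : ℕ → Ω → ℕ → Finset ℕ} (t : ℕ) : Summable (meanLoss μ u d X S t) :=
  summable_of_ne_finset_zero (s := Finset.range t) fun y hy => by
    rw [meanLoss, if_neg (by simpa using hy)]

/-- The limit of `lowerEntropy μ X j`. -/
def lowerLimit (μ : Measure Ω) (u d : ℝ) (X : ℕ → ℤ → Ω → Bool) (j : ℕ) : ℝ :=
  linkEntropy u d 1 / downProb u d + ∑ i ∈ Finset.Ico 1 j,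
    (∑' m, recordTail μ X i m) * (linkEntropy u d (i + 1) - linkEntropy u d i)

lemma lowerLimit_one : lowerLimit μ u d X 1 = linkEntropy u d 1 / downProb u d := by
  simp [lowerLimit]

lemma lowerLimit_succ {j : ℕ} (hj : 1 ≤ j) : lowerLimit μ u d X (j + 1) = lowerLimit μ u d X j +
    (∑' m, recordTail μ X j m) * (linkEntropy u d (j + 1) - linkEntropy u d j) := by
  rw [lowerLimit, Finset.sum_Ico_succ_top hj, ← add_assoc, lowerLimit]

/-- The limit of `upperEntropy μ X j`. -/
def upperLimit (μ : Measure Ω) (u d : ℝ) (X : ℕ → ℤ → Ω → Bool) : ℕ → ℝ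
  | 0 => 0
  | 1 => linkEntropy u d 0 / downProb u d
  | n + 2 => lowerLimit μ u d X (n + 1) +
      (∑' m, recordTail μ X (n + 1) m) * (linkEntropy u d 0 - linkEntropy u d (n + 1))

lemma upperLimit_succ {j : ℕ} (hj : 1 ≤ j) : upperLimit μ u d X (j + 1) = lowerLimit μ u d X j +
    (∑' m, recordTail μ X j m) * (linkEntropy u d 0 - linkEntropy u d j) := by
  obtain ⟨n, rfl⟩ : ∃ n, j = n + 1 := ⟨j - 1, by omega⟩
  rfl

variable [IsProbabilityMeasure μ]

section Observation

variable {β β' : ℕ → Type*} {J J' : ℕ} {F : ∀ t, Ω → β t} {F' : ∀ t, Ω → β' t}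
  {S S' : ℕ → Ω → ℕ → Finset ℕ}

/-- Extending the sum by zeros to all `y` gives an index set free of `t`, as dominated convergence
needs. -/
lemma IsLinkNetwork.condEntropy_eq_tsum (hX : IsLinkNetwork u d μ X)
    (hu : u ∈ Set.Ioo (0 : ℝ) 1) (hd : d ∈ Set.Ioo (0 : ℝ) 1) (hF : IsObservation X J F S) (t : ℕ) :
    condEntropy μ (msg X t) (F t) = ∑' y, meanLoss μ u d X S t y := by
  rw [hX.condEntropy_msg hu hd (hF.observes t) (hF.factors t) (hF.lags_factor t),
    tsum_eq_sum (s := Finset.range t)]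
  · refine Finset.sum_congr rfl fun y hy => ?_
    rw [meanLoss, if_pos (Finset.mem_range.1 hy)]
  · intro y hy
    rw [meanLoss, if_neg (by simpa using hy)]

/-- Lags are bounded by `J`, so the losses are uniformly bounded, and the loss at `y` is incurred
with probability at most `U^y`. -/
lemma IsLinkNetwork.exists_abs_meanLoss_le (hX : IsLinkNetwork u d μ X)
    (hu : u ∈ Set.Ioo (0 : ℝ) 1) (hd : d ∈ Set.Ioo (0 : ℝ) 1) (hF : IsObservation X J F S) :
    ∃ C, ∀ t y, |meanLoss μ u d X S t y| ≤ C * upProb u d ^ y := by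
  obtain ⟨C, hC, hle⟩ := exists_abs_log_lagProb_le u d J
  refine ⟨C, fun t y => ?_⟩
  have hU := pow_nonneg (upProb_pos hu hd).le y
  rw [meanLoss]
  split_ifs with hy
  · have hm := hX.measurableSet_le_msg t y
    have hint : ∫ ω, {ω | y ≤ msg X t ω}.indicator (fun _ => C) ω ∂μ ≤ C * upProb u d ^ y := by
      rw [integral_indicator_const _ hm, smul_eq_mul, mul_comm]
      exact mul_le_mul_of_nonneg_left (hX.measureReal_le_msg_le hu hd t y) hC
    refine le_trans ?_ hint
    rw [← Real.norm_eq_abs]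
    refine norm_integral_le_of_norm_le ((integrable_const C).indicator hm)
      (Eventually.of_forall fun ω => ?_)
    rw [msgLoss, Real.norm_eq_abs]
    split_ifs with h
    · rw [Set.indicator_of_mem (by exact h), logLoss, abs_neg]
      exact hle _ (hF.lags_le t ω y) _ _
    · rw [Set.indicator_of_notMem (by exact h), abs_zero]
  · rw [abs_zero]
    positivity

lemma IsLinkNetwork.integrable_indicator_recordEvent (hX : IsLinkNetwork u d μ X) {n t m i : ℕ}
    (h : m + n ≤ t) (hi : m + i < t) :
    Integrable ((recordEvent X n t m).indicator (logLoss u d X t m i)) μ := by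
  refine Integrable.indicator ?_ (hX.measurableSet_recordEvent h)
  refine integrable_of_factorsThrough (hX.measurable_pattern t) fun ω ω' hω => ?_
  rw [logLoss, logLoss, eq_of_pattern_eq hω (by omega) (by omega) (by omega),
    eq_of_pattern_eq hω (by omega) (by omega) (by omega)]

/-- Two observations that agree whenever one of `M_{t-1}, …, M_{t-n}` reaches link `y + 1`, and
otherwise reveal it at the fixed lags `l` and `l'`. -/
lemma IsLinkNetwork.meanLoss_sub (hX : IsLinkNetwork u d μ X)
    (hu : u ∈ Set.Ioo (0 : ℝ) 1) (hd : d ∈ Set.Ioo (0 : ℝ) 1) (hF : IsObservation X J F S)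
    (hF' : IsObservation X J' F' S') {n t y l l' : ℕ} (hn : y + n ≤ t) (hl : y + l < t)
    (hl' : y + l' < t)
    (h1 : ∀ ω, (∃ i ∈ Finset.Icc 1 n, y ≤ msg X (t - i) ω) →
      sInf (S' t ω y : Set ℕ) = sInf (S t ω y : Set ℕ))
    (h2 : ∀ ω, (∀ i ∈ Finset.Icc 1 n, msg X (t - i) ω < y) →
      sInf (S t ω y : Set ℕ) = l ∧ sInf (S' t ω y : Set ℕ) = l') :
    meanLoss μ u d X S' t y - meanLoss μ u d X S t y =
      recordTail μ X n y * (linkEntropy u d l' - linkEntropy u d l) := by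
  have hy : y < t := by omega
  rw [meanLoss, meanLoss, if_pos hy, if_pos hy, recordTail, ← hX.measureReal_recordEvent_eq hu hd hn,
    mul_sub, ← hX.integral_indicator_recordEvent hu hd hn hl,
    ← hX.integral_indicator_recordEvent hu hd hn hl', ← integral_sub, ← integral_sub]
  · congr 1
    funext ω
    by_cases hrec : ∀ i ∈ Finset.Icc 1 n, msg X (t - i) ω < y
    · obtain ⟨hS, hS'⟩ := h2 ω hrec
      rw [msgLoss, msgLoss, hS, hS']
      split_ifs with hle
      · rw [Set.indicator_of_mem (by exact ⟨hle, hrec⟩), Set.indicator_of_mem (by exact ⟨hle, hrec⟩)]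
      · rw [Set.indicator_of_notMem (fun h => hle h.1), Set.indicator_of_notMem (fun h => hle h.1)]
    · rw [Set.indicator_of_notMem (fun h => hrec h.2), Set.indicator_of_notMem (fun h => hrec h.2),
        sub_self, msgLoss, msgLoss, h1 ω (by push Not at hrec; exact hrec), sub_self]
  · exact hX.integrable_indicator_recordEvent hn hl'
  · exact hX.integrable_indicator_recordEvent hn hl
  · exact hX.integrable_msgLoss (hF'.observes t) hy (hF'.lags_factor t y)
  · exact hX.integrable_msgLoss (hF.observes t) hy (hF.lags_factor t y)

lemma IsLinkNetwork.meanLoss_eq (hX : IsLinkNetwork u d μ X)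
    (hu : u ∈ Set.Ioo (0 : ℝ) 1) (hd : d ∈ Set.Ioo (0 : ℝ) 1) {t y l : ℕ} (hl : y + l < t)
    (h : ∀ ω, sInf (S t ω y : Set ℕ) = l) :
    meanLoss μ u d X S t y = recordTail μ X 0 y * linkEntropy u d l := by
  rw [meanLoss, if_pos (by omega), recordTail,
    ← hX.measureReal_recordEvent_eq hu hd (t := t) (by omega),
    ← hX.integral_indicator_recordEvent hu hd (by omega) hl]
  congr 1
  funext ω
  rw [msgLoss, h]
  split_ifs with hle
  · rw [Set.indicator_of_mem (by exact ⟨hle, by simp⟩)]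
  · rw [Set.indicator_of_notMem (fun h => hle h.1)]

/-- The base case: every link is seen at the same lag `l`, and the probabilities `U^y` of reaching
the links sum to `1 / D`. -/
lemma IsLinkNetwork.tendsto_condEntropy (hX : IsLinkNetwork u d μ X)
    (hu : u ∈ Set.Ioo (0 : ℝ) 1) (hd : d ∈ Set.Ioo (0 : ℝ) 1) (hF : IsObservation X J F S) (l : ℕ)
    (h : ∀ y, ∀ᶠ t in atTop, ∀ ω, sInf (S t ω y : Set ℕ) = l) :
    Tendsto (fun t => condEntropy μ (msg X t) (F t)) atTop
      (𝓝 (linkEntropy u d l / downProb u d)) := by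
  obtain ⟨C, hC⟩ := hX.exists_abs_meanLoss_le hu hd hF
  simp_rw [hX.condEntropy_eq_tsum hu hd hF]
  rw [div_eq_mul_one_div, mul_comm, ← hX.tsum_recordTail_zero hu hd, ← tsum_mul_right]
  refine tendsto_tsum_of_dominated_convergence (summable_mul_upProb_pow hu hd C) (fun y => ?_)
    (Eventually.of_forall hC)
  refine tendsto_const_nhds.congr' ?_
  filter_upwards [h y, eventually_ge_atTop (y + l + 1)] with t ht htl
  exact (hX.meanLoss_eq hu hd (by omega) ht).symm

lemma IsLinkNetwork.tendsto_condEntropy_of_tendsto (hX : IsLinkNetwork u d μ X)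
    (hu : u ∈ Set.Ioo (0 : ℝ) 1) (hd : d ∈ Set.Ioo (0 : ℝ) 1) (hF : IsObservation X J F S)
    (hF' : IsObservation X J' F' S') (n l l' : ℕ) {L : ℝ}
    (hL : Tendsto (fun t => condEntropy μ (msg X t) (F t)) atTop (𝓝 L))
    (h1 : ∀ y, ∀ᶠ t in atTop, ∀ ω, (∃ i ∈ Finset.Icc 1 n, y ≤ msg X (t - i) ω) →
      sInf (S' t ω y : Set ℕ) = sInf (S t ω y : Set ℕ))
    (h2 : ∀ y, ∀ᶠ t in atTop, ∀ ω, (∀ i ∈ Finset.Icc 1 n, msg X (t - i) ω < y) →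
      sInf (S t ω y : Set ℕ) = l ∧ sInf (S' t ω y : Set ℕ) = l') :
    Tendsto (fun t => condEntropy μ (msg X t) (F' t)) atTop
      (𝓝 (L + (∑' m, recordTail μ X n m) * (linkEntropy u d l' - linkEntropy u d l))) := by
  obtain ⟨C, hC⟩ := hX.exists_abs_meanLoss_le hu hd hF
  obtain ⟨C', hC'⟩ := hX.exists_abs_meanLoss_le hu hd hF'
  have hdiff : Tendsto
      (fun t => ∑' y, (meanLoss μ u d X S' t y - meanLoss μ u d X S t y)) atTop
      (𝓝 ((∑' m, recordTail μ X n m) * (linkEntropy u d l' - linkEntropy u d l))) := by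
    rw [← tsum_mul_right]
    refine tendsto_tsum_of_dominated_convergence (summable_mul_upProb_pow hu hd (C' + C))
      (fun y => ?_) (Eventually.of_forall fun t y => ?_)
    · refine tendsto_const_nhds.congr' ?_
      filter_upwards [h1 y, h2 y, eventually_ge_atTop (y + n + l + l' + 1)] with t ht1 ht2 ht
      exact (hX.meanLoss_sub hu hd hF hF' (by omega) (by omega) (by omega) ht1 ht2).symm
    · rw [add_mul]
      exact (norm_sub_le _ _).trans (add_le_add (hC' t y) (hC t y))
  refine (hL.add hdiff).congr fun t => ?_
  rw [hX.condEntropy_eq_tsum hu hd hF, hX.condEntropy_eq_tsum hu hd hF',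
    (summable_meanLoss t).tsum_sub (summable_meanLoss t)]
  ring

end Observation

lemma IsLinkNetwork.tendsto_lowerEntropy_one (hX : IsLinkNetwork u d μ X)
    (hu : u ∈ Set.Ioo (0 : ℝ) 1) (hd : d ∈ Set.Ioo (0 : ℝ) 1) :
    Tendsto (lowerEntropy μ X 1) atTop (𝓝 (linkEntropy u d 1 / downProb u d)) :=
  hX.tendsto_condEntropy hu hd (isObservation_pastMsgs_diag 0) 1 fun y => by
    filter_upwards [eventually_gt_atTop (y + 0 + 1)] with t ht ω
    exact sInf_lowerLags_eq ht (by simp)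

lemma IsLinkNetwork.tendsto_upperEntropy_one (hX : IsLinkNetwork u d μ X)
    (hu : u ∈ Set.Ioo (0 : ℝ) 1) (hd : d ∈ Set.Ioo (0 : ℝ) 1) :
    Tendsto (upperEntropy μ X 1) atTop (𝓝 (linkEntropy u d 0 / downProb u d)) :=
  hX.tendsto_condEntropy hu hd (isObservation_pastMsgs 0) 0 fun _ =>
    Eventually.of_forall fun _ _ => sInf_upperLags_eq (by simp)

lemma IsLinkNetwork.tendsto_lowerEntropy_succ (hX : IsLinkNetwork u d μ X)
    (hu : u ∈ Set.Ioo (0 : ℝ) 1) (hd : d ∈ Set.Ioo (0 : ℝ) 1) (n : ℕ) {L : ℝ}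
    (hL : Tendsto (lowerEntropy μ X (n + 1)) atTop (𝓝 L)) :
    Tendsto (lowerEntropy μ X (n + 1 + 1)) atTop
      (𝓝 (L + (∑' m, recordTail μ X (n + 1) m) *
        (linkEntropy u d (n + 1 + 1) - linkEntropy u d (n + 1)))) := by
  refine hX.tendsto_condEntropy_of_tendsto hu hd (isObservation_pastMsgs_diag n)
    (isObservation_pastMsgs_diag (n + 1)) (n + 1) (n + 1) (n + 1 + 1) hL (fun y => ?_) fun y => ?_
  · filter_upwards [eventually_gt_atTop (y + n + 1)] with t ht ω hω
    obtain ⟨i, h1, h2, -⟩ := sInf_lags_eq_of_exists ht hω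
    rw [h1, h2]
  · filter_upwards [eventually_gt_atTop (y + (n + 1) + 1)] with t ht ω hω
    refine ⟨sInf_lowerLags_eq (by omega) fun i hi => hω i ?_, sInf_lowerLags_eq ht hω⟩
    rw [Finset.mem_Icc] at hi ⊢
    omega

lemma IsLinkNetwork.tendsto_upperEntropy_succ (hX : IsLinkNetwork u d μ X)
    (hu : u ∈ Set.Ioo (0 : ℝ) 1) (hd : d ∈ Set.Ioo (0 : ℝ) 1) (n : ℕ) {L : ℝ}
    (hL : Tendsto (lowerEntropy μ X (n + 1)) atTop (𝓝 L)) :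
    Tendsto (upperEntropy μ X (n + 1 + 1)) atTop
      (𝓝 (L + (∑' m, recordTail μ X (n + 1) m) *
        (linkEntropy u d 0 - linkEntropy u d (n + 1)))) := by
  refine hX.tendsto_condEntropy_of_tendsto hu hd (isObservation_pastMsgs_diag n)
    (isObservation_pastMsgs (n + 1)) (n + 1) (n + 1) 0 hL (fun y => ?_) fun y => ?_
  · filter_upwards [eventually_gt_atTop (y + n + 1)] with t ht ω hω
    obtain ⟨i, h1, -, h3⟩ := sInf_lags_eq_of_exists ht hω
    rw [h1, h3]
  · filter_upwards [eventually_gt_atTop (y + n + 1)] with t ht ω hω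
    refine ⟨sInf_lowerLags_eq ht fun i hi => hω i ?_, sInf_upperLags_eq hω⟩
    rw [Finset.mem_Icc] at hi ⊢
    omega

/-! ### Entropy of a single link -/

lemma IsLinkNetwork.entropy_skipLink (hX : IsLinkNetwork u d μ X)
    (hu : u ∈ Set.Ioo (0 : ℝ) 1) (hd : d ∈ Set.Ioo (0 : ℝ) 1) {j : ℕ} (hj : 1 ≤ j) (n : ℕ) :
    entropy μ (fun ω (i : Fin (n + 1)) => skipLink X j (i + 1) ω) =
      linkEntropy u d 0 + n * linkEntropy u d j := by
  have hidx : ∀ i, j * (i + 1) = j + j * i := fun i => by ring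
  have hV : Measurable (fun ω (i : Fin (n + 1)) => skipLink X j (i + 1) ω) :=
    measurable_pi_lambda _ fun i => hX.measurable _ (by rw [hidx]; omega) _
  -- The initial factor is written as a prediction at lag `0`, so that one formula for the mean loss
  -- serves all factors.
  have hlaw : ∀ ω, μ.real {ω' | (fun i : Fin (n + 1) => skipLink X j (i + 1) ω') =
      fun i : Fin (n + 1) => skipLink X j (i + 1) ω} =
      lagProb u d 0 (X j 1 ω) (X (j + 0) 1 ω) * ∏ i ∈ Finset.range n,
        lagProb u d j (X (j + j * i) 1 ω) (X (j + j * i + j) 1 ω) := by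
    intro ω
    have h := hX.measureReal_path hu hd 1 hj hj n (fun i => X (j + j * i) 1 ω)
    simp only [funext_iff, Fin.forall_iff, skipLink, hidx]
    rw [h]
    simp only [lagProb, mul_zero, add_zero, hidx, add_comm]
  have hint : ∀ s, 1 ≤ s → ∀ i,
      Integrable (fun ω => -Real.log (lagProb u d i (X s 1 ω) (X (s + i) 1 ω))) μ := by
    intro s hs i
    refine integrable_of_factorsThrough (V := fun ω => (X s 1 ω, X (s + i) 1 ω))
      ((hX.measurable s hs 1).prodMk (hX.measurable _ (by omega) 1)) fun ω ω' h => ?_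
    obtain ⟨h1, h2⟩ := Prod.mk.injEq _ _ _ _ ▸ h
    rw [h1, h2]
  have hlog : ∀ ω, -Real.log (lagProb u d 0 (X j 1 ω) (X (j + 0) 1 ω) * ∏ i ∈ Finset.range n,
        lagProb u d j (X (j + j * i) 1 ω) (X (j + j * i + j) 1 ω)) =
      -Real.log (lagProb u d 0 (X j 1 ω) (X (j + 0) 1 ω)) + ∑ i ∈ Finset.range n,
        -Real.log (lagProb u d j (X (j + j * i) 1 ω) (X (j + j * i + j) 1 ω)) := by
    intro ω
    have hne : ∀ i a b, lagProb u d i a b ≠ 0 := fun i a b => (lagProb_pos hu hd i a b).ne'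
    rw [Real.log_mul (hne _ _ _) (Finset.prod_ne_zero_iff.2 fun i _ => hne _ _ _),
      Real.log_prod fun i _ => hne _ _ _, neg_add, Finset.sum_neg_distrib]
  rw [entropy_eq_integral hV]
  simp_rw [hlaw, hlog]
  rw [integral_add (hint j hj 0) (integrable_finsetSum _ fun i _ => hint _ (by omega) j),
    integral_finsetSum _ fun i _ => hint _ (by omega) j,
    hX.integral_neg_log_lagProb hu hd 1 hj,
    Finset.sum_congr rfl fun i _ => hX.integral_neg_log_lagProb hu hd 1 (by omega) j]
  simp

lemma IsLinkNetwork.hasEntropyRate_skipLink (hX : IsLinkNetwork u d μ X)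
    (hu : u ∈ Set.Ioo (0 : ℝ) 1) (hd : d ∈ Set.Ioo (0 : ℝ) 1) {j : ℕ} (hj : 1 ≤ j) :
    HasEntropyRate μ (skipLink X j) (linkEntropy u d j) := by
  rw [HasEntropyRate]
  have h0 : Tendsto (fun t : ℕ => 1 / (t : ℝ)) atTop (𝓝 0) := tendsto_one_div_atTop_nhds_zero_nat
  have h1 : Tendsto (fun t : ℕ => 1 / (t : ℝ) * (linkEntropy u d 0 - linkEntropy u d j) +
      linkEntropy u d j) atTop (𝓝 (linkEntropy u d j)) := by
    simpa using (h0.mul_const (linkEntropy u d 0 - linkEntropy u d j)).add_const (linkEntropy u d j)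
  refine h1.congr' ?_
  filter_upwards [eventually_ge_atTop 1] with t ht
  obtain ⟨n, rfl⟩ : ∃ n, t = n + 1 := ⟨t - 1, by omega⟩
  rw [hX.entropy_skipLink hu hd hj]
  have : ((n + 1 : ℕ) : ℝ) ≠ 0 := by positivity
  field_simp
  push_cast
  ring

/-! ### Limits for every `j` and the main theorem -/

lemma IsLinkNetwork.tendsto_lowerEntropy (hX : IsLinkNetwork u d μ X)
    (hu : u ∈ Set.Ioo (0 : ℝ) 1) (hd : d ∈ Set.Ioo (0 : ℝ) 1) {j : ℕ} (hj : 1 ≤ j) :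
    Tendsto (lowerEntropy μ X j) atTop (𝓝 (lowerLimit μ u d X j)) := by
  induction j, hj using Nat.le_induction with
  | base => rw [lowerLimit_one]; exact hX.tendsto_lowerEntropy_one hu hd
  | succ j hj ih =>
    obtain ⟨n, rfl⟩ : ∃ n, j = n + 1 := ⟨j - 1, by omega⟩
    rw [lowerLimit_succ hj]
    exact hX.tendsto_lowerEntropy_succ hu hd n ih

lemma IsLinkNetwork.tendsto_upperEntropy (hX : IsLinkNetwork u d μ X)
    (hu : u ∈ Set.Ioo (0 : ℝ) 1) (hd : d ∈ Set.Ioo (0 : ℝ) 1) {j : ℕ} (hj : 1 ≤ j) :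
    Tendsto (upperEntropy μ X j) atTop (𝓝 (upperLimit μ u d X j)) := by
  match j, hj with
  | 1, _ => exact hX.tendsto_upperEntropy_one hu hd
  | n + 2, _ => exact hX.tendsto_upperEntropy_succ hu hd n (hX.tendsto_lowerEntropy hu hd (by omega))

end LinkNetwork

end

theorem theorem1 {Ω : Type*} [MeasurableSpace Ω] (μ : MeasureTheory.Measure Ω)
    [MeasureTheory.IsProbabilityMeasure μ] (u d : ℝ) (hu : u ∈ Set.Ioo (0 : ℝ) 1)
    (hd : d ∈ Set.Ioo (0 : ℝ) 1) (X : ℕ → ℤ → Ω → Bool)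
    (hX : LinkNetwork.IsLinkNetwork u d μ X) :
    -- the limits `L j`, `U j`, `p j` and the entropy rates `R j` of `X^{(j)}` exist
    ∃ L U p R : ℕ → ℝ,
      (∀ j : ℕ, 1 ≤ j → Tendsto (LinkNetwork.lowerEntropy μ X j) atTop (𝓝 (L j))) ∧
      (∀ j : ℕ, 1 ≤ j → Tendsto (LinkNetwork.upperEntropy μ X j) atTop (𝓝 (U j))) ∧
      (∀ j : ℕ, 1 ≤ j → Tendsto (LinkNetwork.recordProb μ X j) atTop (𝓝 (p j))) ∧
      (∀ j : ℕ, 1 ≤ j → LinkNetwork.HasEntropyRate μ (LinkNetwork.skipLink X j) (R j)) ∧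
      -- the recursions
      (∀ j : ℕ, 1 ≤ j →
        L (j + 1) = L j + p j / LinkNetwork.downProb u d * (R (j + 1) - R j)) ∧
      (∀ j : ℕ, 1 ≤ j →
        U (j + 1) = L j +
          p j / LinkNetwork.downProb u d * (LinkNetwork.entropy μ (X 1 1) - R j)) ∧
      -- the initial values
      L 1 = R 1 / LinkNetwork.downProb u d ∧
      U 1 = LinkNetwork.entropy μ (X 1 1) / LinkNetwork.downProb u d ∧
      LinkNetwork.entropy μ (X 1 1) = Real.binEntropy (LinkNetwork.upProb u d) := by
  open LinkNetwork in
  have hp : ∀ j, downProb u d * (∑' m, recordTail μ X j m) / downProb u d =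
      ∑' m, recordTail μ X j m := fun j => mul_div_cancel_left₀ _ (downProb_pos hu hd).ne'
  have hH := hX.entropy_state hu hd
  -- The limits are unrolled recursions written with the sum of the record tails, which is `p_j / D`
  -- by `hp`.
  exact ⟨lowerLimit μ u d X, upperLimit μ u d X,
    fun j => downProb u d * ∑' m, recordTail μ X j m, linkEntropy u d,
    fun j hj => hX.tendsto_lowerEntropy hu hd hj, fun j hj => hX.tendsto_upperEntropy hu hd hj,
    fun j _ => hX.tendsto_recordProb hu hd j, fun j hj => hX.hasEntropyRate_skipLink hu hd hj,
    fun j hj => by rw [lowerLimit_succ hj, hp], fun j hj => by rw [upperLimit_succ hj, hp, hH],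
    lowerLimit_one, by rw [hH, upperLimit], by rw [hH, linkEntropy_zero hu hd]⟩
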